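/- Let $(R,\mathfrak m)$ be a Noetherian local ring of dimension $d\ge 1$ and let $\mathbf I=(I_1,\dots,I_s)$ be $\mathfrak m$-primary ideals of $R$. For $\mathbf n\in\mathbb Z^s$ put $\mathbf I^{\mathbf n}=I_1^{n_1}\cdots I_s^{n_s}$ (with $I_i^{n_i}=R$ if $n_i\le 0$) and $\mathbf n^+=(\max\{0,n_1\},\dots,\max\{0,n_s\})$; order $\mathbb Z^s$ componentwise and write $\mathbf e=(1,\dots,1)$ and $\mathbf e_i$ for the $i$-th unit vector. Let $\mathcal F=\{\mathcal F(\mathbf n)\}_{\mathbf n\in\mathbb Z^s}$ be an $\mathbf I$-admissible filtration of ideals of $R$: for all $\mathbf m,\mathbf n\in\mathbb Z^s$, $\mathbf I^{\mathbf n}\subseteq\mathcal F(\mathbf n)$, $\mathcal F(\mathbf n)\mathcal F(\mathbf m)\subseteq\mathcal F(\mathbf n+\mathbf m)$, $\mathcal F(\mathbf m)\subseteq\mathcal F(\mathbf n)$ if $\mathbf m\ge\mathbf n$, and $\mathcal F(\mathbf n)=\mathcal F(\mathbf n^+)$; and $\bigoplus_{\mathbf n\in\mathbb Z^s}\mathcal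 F(\mathbf n)\mathbf t^{\mathbf n}$ is a finite module over $\bigoplus_{\mathbf n\in\mathbb Z^s}\mathbf I^{\mathbf n}\mathbf t^{\mathbf n}$. Let $G(\mathbf I)=\bigoplus_{\mathbf n\in\mathbb N^s}\mathbf I^{\mathbf n}/\mathbf I^{\mathbf n+\mathbf e}$, let $G(\mathbf I)_{++}=\bigoplus_{\mathbf n\ge\mathbf e}G(\mathbf I)_{\mathbf n}$, and let $G(\mathcal F)=\bigoplus_{\mathbf n\in\mathbb N^s}\mathcal F(\mathbf n)/\mathcal F(\mathbf n+\mathbf e)$, a graded $G(\mathbf I)$-module. Let $\mathbf m\in\mathbb Z^s$ and suppose that $G(\mathcal F)$ satisfies Hyry's condition $\operatorname{H}_{G(\mathbf I)}(G(\mathcal F),\mathbf m)$, i.e. the graded pieces of local cohomology $[H^i_{G(\mathbf I)_{++}}(G(\mathcal F))]_{\mathbf n}$ vanish for all $i\ge 0$ and all $\mathbf n\ge\mathbf m$. Let $\mathbf q\in\mathbb N^s$ with $|\mathbf q|=q_1+\dots+q_s=d$ and let $\{a_{ij}\in I_i: 1\le j\le q_i,\ 1\le i\le s\}$ be a joint reduction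 of $\mathcal F$ of type $\mathbf q$, i.e. there is $\mathbf k\in\mathbb N^s$ with $\mathcal F(\mathbf n)=\sum_{i=1}^s\sum_{j=1}^{q_i}a_{ij}\mathcal F(\mathbf n-\mathbf e_i)$ for all $\mathbf n\ge\mathbf k$. Let $a_{ij}^*$ be the image of $a_{ij}$ in $G(\mathbf I)_{\mathbf e_i}=I_i/\mathbf I^{\mathbf e+\mathbf e_i}$, and suppose that $a_{11}^*,\dots,a_{1q_1}^*,\dots,a_{s1}^*,\dots,a_{sq_s}^*$ is a $G(\mathcal F)$-filter-regular sequence, where homogeneous elements $b_1,\dots,b_l$ of $G(\mathbf I)$ form an $M$-filter-regular sequence if for each $k$ there is $\mathbf N$ such that no nonzero element of degree $\mathbf n\ge\mathbf N$ in $M/(b_1,\dots,b_{k-1})M$ is killed by $b_k$. Then $$\mathcal F(\mathbf n)=\sum_{i=1}^{s}\sum_{j=1}^{q_i}a_{ij}\,\mathcal F(\mathbf n-\mathbf e_i)\qquad\text{for all }\mathbf n\ge\mathbf m+\mathbf q .$$ -/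

import Mathlib

noncomputable section

/-! ### Graded local cohomology through the Čech complex

`S` is a commutative ring, `M` an `S`-module with graded pieces `ℳ n` (`n ∈ Γ`), and
`x₁, …, xᵣ ∈ S` are homogeneous elements, `xᵢ` of degree `δᵢ`.  For `σ ⊆ {1, …, r}` put
`x_σ = ∏_{i ∈ σ} xᵢ`; the Čech complex is `C^p = ∏_{|σ| = p} M_{x_σ}`. -/

section Cech

variable {S : Type*} [CommRing S] {r : ℕ}

/-- The localization `M_{x_σ}`. -/
abbrev CechLoc (x : Fin r → S) (M : Type*) [AddCommGroup M] [Module S M]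
    (σ : Finset (Fin r)) : Type _ :=
  LocalizedModule (Submonoid.powers (∏ i ∈ σ, x i)) M

theorem isUnit_algebraMap_end_of_dvd (N : Type*) [AddCommGroup N] [Module S N] {f g : S} (h : f ∣ g)
    (hg : IsUnit (algebraMap S (Module.End S N) g)) : IsUnit (algebraMap S (Module.End S N) f) := by
  obtain ⟨c, rfl⟩ := h
  rw [map_mul] at hg
  have hc : Commute (algebraMap S (Module.End S N) f) (algebraMap S (Module.End S N) c) :=
    (Commute.all f c).map _
  exact (hc.isUnit_mul_iff.mp hg).1

theorem cechLoc_isUnit (x : Fin r → S) (M : Type*) [AddCommGroup M] [Module S M]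
    {σ τ : Finset (Fin r)} (h : σ ⊆ τ) (y : Submonoid.powers (∏ i ∈ σ, x i)) :
    IsUnit (algebraMap S (Module.End S (CechLoc x M τ)) y) := by
  obtain ⟨_, k, rfl⟩ := y
  have h1 : IsUnit (algebraMap S (Module.End S (CechLoc x M τ)) (∏ i ∈ τ, x i)) :=
    IsLocalizedModule.map_units (S := Submonoid.powers (∏ i ∈ τ, x i))
      (LocalizedModule.mkLinearMap (Submonoid.powers (∏ i ∈ τ, x i)) M)
      ⟨∏ i ∈ τ, x i, Submonoid.mem_powers _⟩
  simp only [map_pow]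
  refine IsUnit.pow k (isUnit_algebraMap_end_of_dvd (CechLoc x M τ) ?_ h1)
  exact Finset.prod_dvd_prod_of_subset _ _ _ h

/-- The canonical map `M_{x_σ} → M_{x_τ}` for `σ ⊆ τ`. -/
def cechRes (x : Fin r → S) (M : Type*) [AddCommGroup M] [Module S M]
    {σ τ : Finset (Fin r)} (h : σ ⊆ τ) : CechLoc x M σ →ₗ[S] CechLoc x M τ :=
  LocalizedModule.lift _ (LocalizedModule.mkLinearMap _ M) (cechLoc_isUnit x M h)

/-- The Čech cochains `C^p = ∏_{|σ| = p} M_{x_σ}`. -/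
abbrev CechCochain (x : Fin r → S) (M : Type*) [AddCommGroup M] [Module S M] (p : ℕ) : Type _ :=
  (σ : {σ : Finset (Fin r) // σ.card = p}) → CechLoc x M σ.1

/-- The Čech differential
`(d c)_τ = ∑_{j ∈ τ} (-1)^{#{k ∈ τ : k < j}} c_{τ ∖ {j}}` (restricted to `M_{x_τ}`). -/
def cechDiff (x : Fin r → S) (M : Type*) [AddCommGroup M] [Module S M] (p : ℕ) :
    CechCochain x M p →ₗ[S] CechCochain x M (p + 1) :=
  LinearMap.pi fun τ => ∑ j : {j // j ∈ τ.1},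
    ((-1 : S) ^ (τ.1.filter (· < j.1)).card) •
      (cechRes x M (Finset.erase_subset j.1 τ.1) ∘ₗ
        LinearMap.proj (⟨τ.1.erase j.1, by
          rw [Finset.card_erase_of_mem j.2, τ.2, Nat.add_sub_cancel]⟩ :
          {σ : Finset (Fin r) // σ.card = p}))

variable {Γ : Type*} [AddCommGroup Γ]

/-- The graded piece `[M_f]_n` of the localization of a graded module at a homogeneous element `f`
of degree `δ`: it is generated by (and, for a graded module, consists of) the fractions `z / f^k`
with `z` homogeneous of degree `n + k δ`. -/
def locPiece {M : Type*} [AddCommGroup M] [Module S M] (ℳ : Γ → AddSubgroup M)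
    (f : S) (δ n : Γ) : AddSubgroup (LocalizedModule (Submonoid.powers f) M) :=
  AddSubgroup.closure {y | ∃ k : ℕ, ∃ z ∈ ℳ (n + k • δ),
    y = LocalizedModule.mk z (⟨f ^ k, k, rfl⟩ : Submonoid.powers f)}

/-- The degree-`n` strand `[C^p]_n` of the Čech cochains. -/
def cechStrand {M : Type*} [AddCommGroup M] [Module S M] (ℳ : Γ → AddSubgroup M)
    (x : Fin r → S) (δ : Fin r → Γ) (p : ℕ) (n : Γ) : AddSubgroup (CechCochain x M p) :=
  AddSubgroup.pi Set.univ fun σ => locPiece ℳ (∏ i ∈ σ.1, x i) (∑ i ∈ σ.1, δ i) n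

/-- The cocycles of degree `n` in `C^p`. -/
def cechCocycles {M : Type*} [AddCommGroup M] [Module S M] (ℳ : Γ → AddSubgroup M)
    (x : Fin r → S) (δ : Fin r → Γ) (p : ℕ) (n : Γ) : AddSubgroup (CechCochain x M p) :=
  cechStrand ℳ x δ p n ⊓ (LinearMap.ker (cechDiff x M p)).toAddSubgroup

/-- The coboundaries of degree `n` in `C^p`. -/
def cechCoboundaries {M : Type*} [AddCommGroup M] [Module S M] (ℳ : Γ → AddSubgroup M)
    (x : Fin r → S) (δ : Fin r → Γ) : (p : ℕ) → (n : Γ) → AddSubgroup (CechCochain x M p)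
  | 0, _ => ⊥
  | p + 1, n => (cechStrand ℳ x δ p n).map (cechDiff x M p).toAddMonoidHom

/-- The graded piece `[H^p_J(M)]_n` of the local cohomology of `M` with support in the ideal
`J = (x₁, …, xᵣ)`, as the cohomology of the degree-`n` strand of the Čech complex. -/
abbrev LocalCohomologyPiece {M : Type*} [AddCommGroup M] [Module S M] (ℳ : Γ → AddSubgroup M)
    (x : Fin r → S) (δ : Fin r → Γ) (p : ℕ) (n : Γ) : Type _ :=
  cechCocycles ℳ x δ p n ⧸
    (cechCoboundaries ℳ x δ p n).addSubgroupOf (cechCocycles ℳ x δ p n)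

end Cech

/-! ### Multigraded rings and modules

Everything is graded by `ℤ^s = (Fin s → ℤ)`; an `ℕ^s`-graded object has zero pieces outside
`ℕ^s`. -/

section Multigraded

variable {s : ℕ} {S : Type*} [CommRing S]

/-- The ideal `S₊₊ = ⨁_{n ≥ (1, …, 1)} S_n`. -/
def plusPlusIdeal (𝒮 : (Fin s → ℤ) → AddSubgroup S) : Ideal S :=
  Ideal.span {y | ∃ n : Fin s → ℤ, 1 ≤ n ∧ y ∈ 𝒮 n}

/-- Hyry's condition `H_S(M, m)`: `[H^p_{S₊₊}(M)]_n = 0` for all `p ≥ 0` and all `n ≥ m`.  The local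
cohomology is computed from a finite system of homogeneous generators of `S₊₊`; up to isomorphism
it does not depend on the system. -/
def HyryCondition (𝒮 : (Fin s → ℤ) → AddSubgroup S)
    {M : Type*} [AddCommGroup M] [Module S M] (ℳ : (Fin s → ℤ) → AddSubgroup M)
    (m : Fin s → ℤ) : Prop :=
  ∃ (r : ℕ) (x : Fin r → S) (δ : Fin r → (Fin s → ℤ)),
    (∀ i, x i ∈ 𝒮 (δ i)) ∧ Ideal.span (Set.range x) = plusPlusIdeal 𝒮 ∧
    ∀ (p : ℕ) (n : Fin s → ℤ), m ≤ n → Subsingleton (LocalCohomologyPiece ℳ x δ p n)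

/-- A (homogeneous) element `a` is `M`-filter-regular if `(0 :_M a)_n = 0` for all large `n`. -/
def IsFilterRegular {M : Type*} [AddCommGroup M] [Module S M] (ℳ : (Fin s → ℤ) → AddSubgroup M)
    (a : S) : Prop :=
  ∃ N : Fin s → ℤ, ∀ n, N ≤ n → ∀ z ∈ ℳ n, a • z = 0 → z = 0

/-- `a₁, …, aₗ` (homogeneous) is an `M`-filter-regular sequence if each `a_{k+1}` is filter-regular
on the graded module `M / (a₁, …, a_k) M`. -/
def IsFilterRegularSeq {M : Type*} [AddCommGroup M] [Module S M]
    (ℳ : (Fin s → ℤ) → AddSubgroup M) (l : List S) : Prop :=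
  ∀ (k : ℕ) (hk : k < l.length),
    IsFilterRegular
      (fun n => (ℳ n).map
        (Submodule.mkQ (Ideal.ofList (l.take k) • (⊤ : Submodule S M))).toAddMonoidHom)
      l[k]

end Multigraded

/-! ### Filtrations of ideals, Rees rings and associated graded rings -/

section Rees

variable {R : Type*} [CommRing R] {s : ℕ}

/-- `I^n = I₁^{n₁} ⋯ I_s^{n_s}`, where a negative exponent counts as `0`. -/
def idealPow (I : Fin s → Ideal R) (n : Fin s → ℤ) : Ideal R :=
  ∏ i, I i ^ (n i).toNat

/-- A `ℤ^s`-graded `I`-filtration of ideals. -/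
structure MultiFiltration (I : Fin s → Ideal R) where
  toFun : (Fin s → ℤ) → Ideal R
  pow_le : ∀ n, idealPow I n ≤ toFun n
  mul_le : ∀ m n, toFun m * toFun n ≤ toFun (m + n)
  anti : ∀ m n, n ≤ m → toFun m ≤ toFun n

instance (I : Fin s → Ideal R) : CoeFun (MultiFiltration I) (fun _ => (Fin s → ℤ) → Ideal R) :=
  ⟨MultiFiltration.toFun⟩

/-- The ring `R[t₁^{±1}, …, t_s^{±1}]` of Laurent polynomials. -/
def MLaurent (R : Type*) [CommRing R] (s : ℕ) : Type _ := AddMonoidAlgebra R (Fin s → ℤ)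

namespace MLaurent

instance : CommRing (MLaurent R s) := inferInstanceAs (CommRing (AddMonoidAlgebra R (Fin s → ℤ)))

instance : Algebra R (MLaurent R s) :=
  inferInstanceAs (Algebra R (AddMonoidAlgebra R (Fin s → ℤ)))

/-- The coefficient of `t^n`. -/
def coeff (f : MLaurent R s) (n : Fin s → ℤ) : R := AddMonoidAlgebra.coeff f n

/-- The monomial `c t^n`. -/
def single (n : Fin s → ℤ) (c : R) : MLaurent R s := AddMonoidAlgebra.single n c

theorem coeff_zero (n : Fin s → ℤ) : (0 : MLaurent R s).coeff n = 0 := rfl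

theorem coeff_add (f g : MLaurent R s) (n : Fin s → ℤ) :
    (f + g).coeff n = f.coeff n + g.coeff n := rfl

theorem coeff_neg (f : MLaurent R s) (n : Fin s → ℤ) : (-f).coeff n = -f.coeff n := rfl

theorem coeff_smul (c : R) (f : MLaurent R s) (n : Fin s → ℤ) :
    (c • f).coeff n = c * f.coeff n := rfl

theorem coeff_mul (f g : MLaurent R s) (n : Fin s → ℤ) :
    (f * g).coeff n = ∑ m₁ ∈ (AddMonoidAlgebra.coeff f).support,
      ∑ m₂ ∈ (AddMonoidAlgebra.coeff g).support,
        if m₁ + m₂ = n then f.coeff m₁ * g.coeff m₂ else 0 :=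
  AddMonoidAlgebra.coeff_mul (R := R) (M := Fin s → ℤ) f g n

theorem single_zero_one : single (0 : Fin s → ℤ) (1 : R) = 1 := rfl

end MLaurent

/-- Laurent polynomials `∑ cₙ t^n` (finite sums over `n ∈ ℤ^s`) with `cₙ ∈ A n` for all `n`,
i.e. `⨁ₙ A(n) t^n`. -/
def coeffIn (A : (Fin s → ℤ) → Ideal R) : Submodule R (MLaurent R s) where
  carrier := {f | ∀ n, f.coeff n ∈ A n}
  zero_mem' n := (A n).zero_mem
  add_mem' hf hg n := (A n).add_mem (hf n) (hg n)
  smul_mem' c _ hf n := (A n).mul_mem_left c (hf n)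

open Classical in
/-- The family `A`, replaced by zero outside `ℕ^s`. -/
def natPart (A : (Fin s → ℤ) → Ideal R) (n : Fin s → ℤ) : Ideal R :=
  if 0 ≤ n then A n else ⊥

theorem natPart_mul_le {A B C : (Fin s → ℤ) → Ideal R}
    (h : ∀ m n, A m * B n ≤ C (m + n)) (m n : Fin s → ℤ) :
    natPart A m * natPart B n ≤ natPart C (m + n) := by
  unfold natPart
  split_ifs with h1 h2 h3 h3 <;> first
    | exact h m n
    | exact absurd (add_nonneg h1 h2) h3
    | simp

theorem mul_mem_coeffIn {A B C : (Fin s → ℤ) → Ideal R}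
    (h : ∀ m n, A m * B n ≤ C (m + n)) {f g : MLaurent R s}
    (hf : f ∈ coeffIn A) (hg : g ∈ coeffIn B) : f * g ∈ coeffIn C := by
  classical
  intro n
  rw [MLaurent.coeff_mul]
  refine Ideal.sum_mem _ fun m₁ _ => Ideal.sum_mem _ fun m₂ _ => ?_
  split_ifs with hn
  · rw [← hn]
    exact h m₁ m₂ (Ideal.mul_mem_mul (hf m₁) (hg m₂))
  · exact Ideal.zero_mem _

theorem single_mem_coeffIn {A : (Fin s → ℤ) → Ideal R} {n : Fin s → ℤ} {c : R} (hc : c ∈ A n) :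
    MLaurent.single n c ∈ coeffIn A := by
  classical
  intro k
  change (AddMonoidAlgebra.coeff (AddMonoidAlgebra.single n c)) k ∈ A k
  rw [AddMonoidAlgebra.coeff_single, Finsupp.single_apply]
  split_ifs with h
  · exact h ▸ hc
  · exact Ideal.zero_mem _

theorem idealPow_of_nonpos (I : Fin s → Ideal R) {n : Fin s → ℤ} (h : n ≤ 0) :
    idealPow I n = ⊤ := by
  unfold idealPow
  rw [← Ideal.one_eq_top]
  refine Finset.prod_eq_one fun i _ => ?_
  rw [Int.toNat_of_nonpos (h i), pow_zero]

theorem idealPow_mul_le (I : Fin s → Ideal R) (m n : Fin s → ℤ) :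
    idealPow I m * idealPow I n ≤ idealPow I (m + n) := by
  unfold idealPow
  rw [← Finset.prod_mul_distrib]
  refine Finset.prod_le_prod' fun i _ => ?_
  rw [← pow_add]
  exact Ideal.pow_le_pow_right (by simp only [Pi.add_apply]; omega)

theorem idealPow_single (I : Fin s → Ideal R) (i : Fin s) :
    idealPow I (Pi.single i 1) = I i := by
  unfold idealPow
  rw [Finset.prod_eq_single i]
  · simp
  · intro j _ hj
    simp [Pi.single_eq_of_ne hj]
  · simp

/-- The extended Rees ring `ℛ'(I) = ⨁_{n ∈ ℤ^s} I^n t^n`. -/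
def extReesRing (I : Fin s → Ideal R) : Subalgebra R (MLaurent R s) :=
  (coeffIn (idealPow I)).toSubalgebra
    (single_mem_coeffIn (by rw [idealPow_of_nonpos I le_rfl]; trivial))
    (fun _ _ => mul_mem_coeffIn (idealPow_mul_le I))

/-- The Rees ring `ℛ(I) = ⨁_{n ∈ ℕ^s} I^n t^n`. -/
def reesRing (I : Fin s → Ideal R) : Subalgebra R (MLaurent R s) :=
  (coeffIn (natPart (idealPow I))).toSubalgebra
    (single_mem_coeffIn (by
      rw [natPart, if_pos le_rfl, idealPow_of_nonpos I le_rfl]; trivial))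
    (fun _ _ => mul_mem_coeffIn (natPart_mul_le (idealPow_mul_le I)))

/-- The ideal `⨁_{n ∈ ℕ^s} I^{n+e} t^n` of `ℛ(I)`, with `e = (1, …, 1)`. -/
def reesShiftIdeal (I : Fin s → Ideal R) : Ideal (reesRing I) where
  carrier := {f | (f : MLaurent R s) ∈
    coeffIn (natPart fun n => idealPow I (n + 1))}
  zero_mem' := Submodule.zero_mem (coeffIn (natPart fun n => idealPow I (n + 1)))
  add_mem' hf hg := Submodule.add_mem (coeffIn (natPart fun n => idealPow I (n + 1))) hf hg
  smul_mem' c _ hf := mul_mem_coeffIn (natPart_mul_le (fun m n => by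
    rw [add_assoc]; exact idealPow_mul_le I m (n + 1))) c.2 hf

/-- The associated graded ring `G(I) = ⨁_{n ∈ ℕ^s} I^n / I^{n+e}`. -/
def AssocRing (I : Fin s → Ideal R) : Type _ := reesRing I ⧸ reesShiftIdeal I

instance (I : Fin s → Ideal R) : CommRing (AssocRing I) :=
  inferInstanceAs (CommRing (reesRing I ⧸ reesShiftIdeal I))

/-- The projection `ℛ(I) → G(I)`. -/
def AssocRing.mk (I : Fin s → Ideal R) : reesRing I →+* AssocRing I :=
  Ideal.Quotient.mk (reesShiftIdeal I)

/-- The graded piece `G(I)_n`. -/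
def assocRingPiece (I : Fin s → Ideal R) (n : Fin s → ℤ) : AddSubgroup (AssocRing I) :=
  AddSubgroup.map (AssocRing.mk I).toAddMonoidHom
    { carrier := {f | ∀ k, k ≠ n → (f : MLaurent R s).coeff k = 0}
      zero_mem' := fun _ _ => rfl
      add_mem' := fun {f g} hf hg k hk => by
        change (f : MLaurent R s).coeff k + (g : MLaurent R s).coeff k = 0
        rw [hf k hk, hg k hk, add_zero]
      neg_mem' := fun {f} hf k hk => by
        change -(f : MLaurent R s).coeff k = 0
        rw [hf k hk, neg_zero] }

/-- The image `a^*` of `a ∈ I_i` in `G(I)_{e_i} = I_i / I^{e_i + e}`. -/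
def initialForm (I : Fin s → Ideal R) (i : Fin s) (a : I i) : AssocRing I :=
  AssocRing.mk I
    ⟨MLaurent.single (Pi.single i 1) (a : R), single_mem_coeffIn (by
      rw [natPart, if_pos (Pi.single_nonneg.mpr zero_le_one), idealPow_single]; exact a.2)⟩

namespace MultiFiltration

variable {I : Fin s → Ideal R} (F : MultiFiltration I)

theorem pow_mul_le (m n : Fin s → ℤ) : idealPow I m * F n ≤ F (m + n) :=
  (Ideal.mul_mono_left (F.pow_le m)).trans (F.mul_le m n)

/-- The extended Rees ring `ℛ'(F) = ⨁_{n ∈ ℤ^s} F(n) t^n`, as an `ℛ'(I)`-module. -/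
def extReesModule : Submodule (extReesRing I) (MLaurent R s) where
  carrier := coeffIn F
  zero_mem' := Submodule.zero_mem _
  add_mem' hf hg := Submodule.add_mem _ hf hg
  smul_mem' c _ hf := mul_mem_coeffIn F.pow_mul_le c.2 hf

/-- `F` is an `I`-admissible filtration: `F(n) = F(n⁺)` for all `n ∈ ℤ^s`, and `ℛ'(F)` is a finite
`ℛ'(I)`-module. -/
structure IsAdmissible : Prop where
  eq_pos : ∀ n : Fin s → ℤ, F n = F (n ⊔ 0)
  finite : Module.Finite (extReesRing I) F.extReesModule

/-- The Rees ring `ℛ(F) = ⨁_{n ∈ ℕ^s} F(n) t^n`, as an `ℛ(I)`-module. -/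
def reesModule : Submodule (reesRing I) (MLaurent R s) where
  carrier := coeffIn (natPart F)
  zero_mem' := Submodule.zero_mem _
  add_mem' hf hg := Submodule.add_mem _ hf hg
  smul_mem' c _ hf := mul_mem_coeffIn (natPart_mul_le F.pow_mul_le) c.2 hf

/-- The submodule `⨁_{n ∈ ℕ^s} F(n+e) t^n` of `ℛ(F)`, with `e = (1, …, 1)`. -/
def reesShift : Submodule (reesRing I) F.reesModule where
  carrier := {f | (f : MLaurent R s) ∈ coeffIn (natPart fun n => F (n + 1))}
  zero_mem' := Submodule.zero_mem (coeffIn (natPart fun n => F (n + 1)))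
  add_mem' hf hg := Submodule.add_mem (coeffIn (natPart fun n => F (n + 1))) hf hg
  smul_mem' c _ hf := mul_mem_coeffIn (natPart_mul_le (fun m n => by
    rw [add_assoc]; exact F.pow_mul_le m (n + 1))) c.2 hf

/-- The associated graded object `G(F) = ⨁_{n ∈ ℕ^s} F(n) / F(n+e)`. -/
def Assoc : Type _ := F.reesModule ⧸ F.reesShift

instance : AddCommGroup F.Assoc := inferInstanceAs (AddCommGroup (F.reesModule ⧸ F.reesShift))

instance : Module (reesRing I) F.Assoc :=
  inferInstanceAs (Module (reesRing I) (F.reesModule ⧸ F.reesShift))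

/-- The projection `ℛ(F) → G(F)`. -/
def assocMk : F.reesModule →ₗ[reesRing I] F.Assoc := F.reesShift.mkQ

theorem assoc_isTorsionBySet :
    Module.IsTorsionBySet (reesRing I) F.Assoc (reesShiftIdeal I : Set (reesRing I)) := by
  intro z c
  obtain ⟨f, rfl⟩ := Submodule.Quotient.mk_surjective F.reesShift z
  refine (Submodule.Quotient.mk_eq_zero F.reesShift (x := (c : reesRing I) • f)).mpr ?_
  refine mul_mem_coeffIn (natPart_mul_le (A := fun n => idealPow I (n + 1)) (B := F)
    (C := fun n => F (n + 1)) fun m n => ?_) c.2 f.2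
  have h := F.pow_mul_le (m + 1) n
  rwa [add_right_comm] at h

/-- `G(F)` is a `G(I)`-module; the class of `c ∈ ℛ(I)` acts by multiplication by `c`. -/
instance : Module (AssocRing I) F.Assoc :=
  letI : Module (reesRing I ⧸ reesShiftIdeal I) F.Assoc := F.assoc_isTorsionBySet.module
  inferInstanceAs (Module (reesRing I ⧸ reesShiftIdeal I) F.Assoc)

/-- The graded piece `G(F)_n`. -/
def assocPiece (n : Fin s → ℤ) : AddSubgroup F.Assoc :=
  AddSubgroup.map F.assocMk.toAddMonoidHom
    { carrier := {f | ∀ k, k ≠ n → (f : MLaurent R s).coeff k = 0}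
      zero_mem' := fun _ _ => rfl
      add_mem' := fun {f g} hf hg k hk => by
        change (f : MLaurent R s).coeff k + (g : MLaurent R s).coeff k = 0
        rw [hf k hk, hg k hk, add_zero]
      neg_mem' := fun {f} hf k hk => by
        change -(f : MLaurent R s).coeff k = 0
        rw [hf k hk, neg_zero] }

/-- `{a_{ij} ∈ I_i}` is a joint reduction of `F` of type `q`:
`∑_i ∑_j a_{ij} F(n - e_i) = F(n)` for all `n ≥ m`, for some `m ∈ ℕ^s`. -/
def IsJointReduction {q : Fin s → ℕ} (a : (i : Fin s) → Fin (q i) → I i) : Prop :=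
  ∃ m : Fin s → ℕ, ∀ n : Fin s → ℤ, (fun i => (m i : ℤ)) ≤ n →
    ∑ i, ∑ j, Ideal.span {(a i j : R)} * F (n - Pi.single i 1) = F n

end MultiFiltration

end Rees

end

/-!
Write `M = G(F)` and let `b₁, …, b_d` be the initial forms `a_{ij}^*`, `b_k` of degree `ε_k`, so that
`ε₁ + … + ε_d = q`.

If `b` is filter-regular on a graded module `A` then `(0 :_A b)` vanishes in high degrees, so it is
torsion with respect to `G(I)₊₊` and disappears from cohomology in positive degrees.  Hence the
sequence `0 → (A / (0 : b))(-ε) → A → A / bA → 0` shows that `[H^p(A / bA)]_n` vanishes when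
`[H^p(A)]_n` and `[H^{p+1}(A)]_{n-ε}` do.  On the strands of the Čech complex this is a direct
diagram chase, `cechCocycles_le_of_ker_eq_smul`, which needs neither long exact sequences nor
independence of the chosen generators of `G(I)₊₊`.  By induction on the length of the sequence
(`cechCocycles_le_of_isFilterRegularSeq`), `[H^0(M / (b₁, …, b_d) M)]_n = 0` for `n ≥ m + q`.

The joint reduction makes `M / (b₁, …, b_d) M` vanish in high degrees, so that module is torsion and
equals its own `H^0`; it therefore vanishes in all degrees `n ≥ m + q`
(`mem_smul_top_of_isFilterRegularSeq`).  Read in `R`, this says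
`F(n) ⊆ ∑ a_{ij} F(n - e_i) + F(n + e)` for `n ≥ m + q` in `ℕ^s`.  Iterating replaces `F(n + e)` by
`F(n + t e)` for every `t`, and for large `t` the joint reduction absorbs that term
(`MultiFiltration.le_jointSum_of_le_sup`).  Degrees with negative entries reduce to `ℕ^s` by
`F(n) = F(n⁺)`.

The projections of a graded module to its pieces are packaged in `GradedProj`, which passes to the
quotient by a homogeneous element (`GradedProj.ofSurjective`).
-/

noncomputable section

/-! ### The Čech complex is a functorial complex -/

section CechFunctoriality

variable {S : Type*} [CommRing S] {r : ℕ} (x : Fin r → S)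
  {M : Type*} [AddCommGroup M] [Module S M] {A : Type*} [AddCommGroup A] [Module S A]
  {B : Type*} [AddCommGroup B] [Module S B]

theorem cechRes_mkLinearMap {σ τ : Finset (Fin r)} (h : σ ⊆ τ) (z : M) :
    cechRes x M h (LocalizedModule.mkLinearMap _ M z) = LocalizedModule.mkLinearMap _ M z :=
  LinearMap.congr_fun (LocalizedModule.lift_comp _ _ (cechLoc_isUnit x M h)) z

theorem cechRes_mk {σ τ : Finset (Fin r)} (h : σ ⊆ τ) (z : M) (k : ℕ) :
    cechRes x M h (LocalizedModule.mk z ⟨(∏ i ∈ σ, x i) ^ k, k, rfl⟩) =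
      LocalizedModule.mk ((∏ i ∈ τ \ σ, x i) ^ k • z)
        (⟨(∏ i ∈ τ, x i) ^ k, k, rfl⟩ : Submonoid.powers (∏ i ∈ τ, x i)) := by
  have hprod : (∏ i ∈ τ \ σ, x i) * ∏ i ∈ σ, x i = ∏ i ∈ τ, x i := Finset.prod_sdiff h
  have hunit := (Module.End.isUnit_iff _).mp
    (cechLoc_isUnit x M h ⟨(∏ i ∈ σ, x i) ^ k, k, rfl⟩)
  apply hunit.injective
  simp only [Module.algebraMap_end_apply]
  have key : (⟨(∏ i ∈ σ, x i) ^ k, k, rfl⟩ : Submonoid.powers (∏ i ∈ σ, x i)) •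
      (LocalizedModule.mk z ⟨(∏ i ∈ σ, x i) ^ k, k, rfl⟩ : CechLoc x M σ) =
      LocalizedModule.mkLinearMap _ M z := by
    rw [Submonoid.smul_def, LocalizedModule.smul'_mk]
    exact LocalizedModule.mk_cancel
      (⟨(∏ i ∈ σ, x i) ^ k, k, rfl⟩ : Submonoid.powers (∏ i ∈ σ, x i)) z
  rw [← map_smul]
  erw [key]
  rw [cechRes_mkLinearMap, LocalizedModule.smul'_mk, smul_smul, ← mul_pow, mul_comm, hprod]
  exact (LocalizedModule.mk_cancel
    (⟨(∏ i ∈ τ, x i) ^ k, k, rfl⟩ : Submonoid.powers (∏ i ∈ τ, x i)) z).symm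

theorem cechRes_cechRes {ρ σ τ : Finset (Fin r)} (h : ρ ⊆ σ) (h' : σ ⊆ τ) (y : CechLoc x M ρ) :
    cechRes x M h' (cechRes x M h y) = cechRes x M (h.trans h') y := by
  have : cechRes x M h' ∘ₗ cechRes x M h = cechRes x M (h.trans h') := by
    refine IsLocalizedModule.ext (Submonoid.powers (∏ i ∈ ρ, x i))
      (LocalizedModule.mkLinearMap _ M) (cechLoc_isUnit x M (h.trans h')) ?_
    ext z
    simp only [LinearMap.comp_apply, cechRes_mkLinearMap]
  exact LinearMap.congr_fun this y

theorem cechDiff_apply (p : ℕ) (c : CechCochain x M p)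
    (τ : {σ : Finset (Fin r) // σ.card = p + 1}) :
    cechDiff x M p c τ = ∑ j : {j // j ∈ τ.1}, ((-1 : S) ^ (τ.1.filter (· < j.1)).card) •
      cechRes x M (Finset.erase_subset j.1 τ.1) (c ⟨τ.1.erase j.1, by
          rw [Finset.card_erase_of_mem j.2, τ.2, Nat.add_sub_cancel]⟩) := by
  simp [cechDiff, LinearMap.sum_apply]

/-- Removing `j` and then `k`, or `k` and then `j`, gives opposite signs. -/
theorem cech_sign_swap {τ : Finset (Fin r)} {j k : Fin r} (hk : k ∈ τ)
    (hjk : k < j) :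
    (τ.filter (· < j)).card + ((τ.erase j).filter (· < k)).card =
      (τ.filter (· < k)).card + ((τ.erase k).filter (· < j)).card + 1 := by
  have h1 : (τ.erase j).filter (· < k) = τ.filter (· < k) := by
    ext i
    simp only [Finset.mem_filter, Finset.mem_erase]
    exact ⟨fun h => ⟨h.1.2, h.2⟩, fun h => ⟨⟨(h.2.trans hjk).ne, h.1⟩, h.2⟩⟩
  have h2 : (τ.erase k).filter (· < j) = (τ.filter (· < j)).erase k := Finset.filter_erase _ _ _
  have h3 : k ∈ τ.filter (· < j) := Finset.mem_filter.mpr ⟨hk, hjk⟩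
  rw [h1, h2, add_assoc, Finset.card_erase_add_one h3, add_comm]

theorem cechDiff_cechDiff (p : ℕ) (c : CechCochain x M p) :
    cechDiff x M (p + 1) (cechDiff x M p c) = 0 := by
  funext τ
  rw [cechDiff_apply]
  simp only [cechDiff_apply, map_sum, map_smul, cechRes_cechRes, Finset.smul_sum, smul_smul,
    ← pow_add]
  rw [Finset.sum_sigma', Pi.zero_apply]
  -- The terms that remove `j` and then `k` cancel against those that remove `k` and then `j`.
  refine Finset.sum_involution
    (fun a _ => ⟨⟨a.2.1, Finset.mem_of_mem_erase a.2.2⟩,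
      ⟨a.1.1, Finset.mem_erase.mpr ⟨(Finset.ne_of_mem_erase a.2.2).symm, a.1.2⟩⟩⟩) ?_ ?_ ?_ ?_
  · rintro ⟨⟨j, hj⟩, ⟨k, hk⟩⟩ -
    have hres : ∀ (ρ ρ' : {σ : Finset (Fin r) // σ.card = p}) (_ : ρ = ρ') (h : ρ.1 ⊆ τ.1)
        (h' : ρ'.1 ⊆ τ.1), cechRes x M h (c ρ) = cechRes x M h' (c ρ') := by
      rintro ρ _ rfl _ _; rfl
    have hk' := Finset.mem_of_mem_erase hk
    dsimp only at hk ⊢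
    have hcard : ∀ {i l : Fin r}, i ∈ τ.1 → l ∈ τ.1.erase i →
        ((τ.1.erase i).erase l).card = p := fun {i l} hi hl => by
      rw [Finset.card_erase_of_mem hl, Finset.card_erase_of_mem hi, τ.2]
      rfl
    have hj' : j ∈ τ.1.erase k :=
      Finset.mem_erase.mpr ⟨(Finset.ne_of_mem_erase hk).symm, hj⟩
    have hsub : ∀ i l : Fin r, (τ.1.erase i).erase l ⊆ τ.1 := fun i l =>
      (Finset.erase_subset _ _).trans (Finset.erase_subset _ _)
    rw [hres ⟨(τ.1.erase j).erase k, hcard hj hk⟩ ⟨(τ.1.erase k).erase j, hcard hk' hj'⟩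
      (Subtype.ext Finset.erase_right_comm) (hsub j k) (hsub k j), ← add_smul]
    rcases lt_or_gt_of_ne (Finset.ne_of_mem_erase hk) with h | h
    · rw [cech_sign_swap hk' h, pow_succ, mul_neg_one, neg_add_cancel, zero_smul]
    · rw [cech_sign_swap hj h, pow_succ, mul_neg_one, add_neg_cancel, zero_smul]
  · rintro ⟨⟨j, hj⟩, ⟨k, hk⟩⟩ - - h
    have h1 := congrArg (fun a => a.1.1) h
    exact Finset.ne_of_mem_erase hk h1
  · intro a _
    exact Finset.mem_sigma.mpr ⟨Finset.mem_univ _, Finset.mem_univ _⟩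
  · intro a _
    rfl

/-- The map `A_{x_σ} → B_{x_σ}` induced by `π : A → B`. -/
def cechLocMap (π : A →ₗ[S] B) (σ : Finset (Fin r)) : CechLoc x A σ →ₗ[S] CechLoc x B σ :=
  IsLocalizedModule.map (Submonoid.powers (∏ i ∈ σ, x i))
    (LocalizedModule.mkLinearMap _ A) (LocalizedModule.mkLinearMap _ B) π

theorem cechLocMap_mk (π : A →ₗ[S] B) (σ : Finset (Fin r)) (z : A)
    (f : Submonoid.powers (∏ i ∈ σ, x i)) :
    cechLocMap x π σ (LocalizedModule.mk z f) = LocalizedModule.mk (π z) f :=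
  IsLocalizedModule.map_LocalizedModules _ π z f

theorem cechLocMap_cechRes (π : A →ₗ[S] B) {σ τ : Finset (Fin r)} (h : σ ⊆ τ)
    (y : CechLoc x A σ) :
    cechLocMap x π τ (cechRes x A h y) = cechRes x B h (cechLocMap x π σ y) := by
  induction y using LocalizedModule.induction_on with
  | h z f =>
    obtain ⟨_, k, rfl⟩ := f
    rw [cechRes_mk, cechLocMap_mk, cechLocMap_mk, cechRes_mk, map_smul]

/-- The map of Čech cochains induced by `π : A → B`. -/
def cechMap (π : A →ₗ[S] B) (p : ℕ) : CechCochain x A p →ₗ[S] CechCochain x B p :=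
  LinearMap.pi fun σ => cechLocMap x π σ.1 ∘ₗ LinearMap.proj σ

theorem cechMap_apply (π : A →ₗ[S] B) (p : ℕ) (c : CechCochain x A p)
    (σ : {σ : Finset (Fin r) // σ.card = p}) :
    cechMap x π p c σ = cechLocMap x π σ.1 (c σ) := rfl

theorem cechMap_cechDiff (π : A →ₗ[S] B) (p : ℕ) (c : CechCochain x A p) :
    cechMap x π (p + 1) (cechDiff x A p c) = cechDiff x B p (cechMap x π p c) := by
  funext τ
  simp only [cechMap_apply, cechDiff_apply, map_sum, map_smul, cechLocMap_cechRes]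

end CechFunctoriality

/-! ### Graded modules and the strands of the Čech complex -/

section GradedCech

variable {S : Type*} [CommRing S] {r : ℕ} {Γ : Type*} [AddCommGroup Γ]
  {M : Type*} [AddCommGroup M] [Module S M] {A : Type*} [AddCommGroup A] [Module S A]
  {B : Type*} [AddCommGroup B] [Module S B]

/-- A grading of the `S`-module `M` with pieces `ℳ n`, given by the projections to the pieces:
every element is the sum of finitely many of its components, and multiplication by a homogeneous
element of `S` shifts components.  No grading axioms are asked of the family `𝒮`. -/
structure GradedProj (𝒮 : Γ → AddSubgroup S) (ℳ : Γ → AddSubgroup M) where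
  proj : Γ → M →+ M
  proj_mem : ∀ n z, proj n z ∈ ℳ n
  proj_eq_self : ∀ n, ∀ z ∈ ℳ n, proj n z = z
  proj_smul : ∀ ε n, ∀ y ∈ 𝒮 ε, ∀ z, proj (n + ε) (y • z) = y • proj n z
  finite : ∀ z, ∃ T : Finset Γ, z = ∑ n ∈ T, proj n z

namespace GradedProj

variable {𝒮 : Γ → AddSubgroup S} {ℳ : Γ → AddSubgroup M}

theorem smul_mem (G : GradedProj 𝒮 ℳ) {ε n : Γ} {y : S} (hy : y ∈ 𝒮 ε) {z : M} (hz : z ∈ ℳ n) :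
    y • z ∈ ℳ (n + ε) := by
  have h := G.proj_smul ε n y hy z
  rw [G.proj_eq_self n z hz] at h
  exact h ▸ G.proj_mem _ _

theorem prod_smul_mem (G : GradedProj 𝒮 ℳ) {x : Fin r → S} {δ : Fin r → Γ}
    (hx : ∀ i, x i ∈ 𝒮 (δ i)) (σ : Finset (Fin r)) {n : Γ} {z : M} (hz : z ∈ ℳ n) :
    (∏ i ∈ σ, x i) • z ∈ ℳ (n + ∑ i ∈ σ, δ i) := by
  induction σ using Finset.induction_on with
  | empty => simpa using hz
  | insert i σ hi ih =>
    rw [Finset.prod_insert hi, Finset.sum_insert hi, mul_smul, add_comm (δ i), ← add_assoc]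
    exact G.smul_mem (hx i) ih

/-- If `b` is homogeneous, a multiple of `b` that is homogeneous is `b` times a homogeneous
element. -/
theorem exists_smul_eq (G : GradedProj 𝒮 ℳ) {ε n : Γ} {b : S} (hb : b ∈ 𝒮 ε) {w : M}
    (hw : b • w ∈ ℳ n) : ∃ w' ∈ ℳ (n - ε), b • w = b • w' := by
  refine ⟨G.proj (n - ε) w, G.proj_mem _ _, ?_⟩
  rw [← G.proj_smul ε (n - ε) b hb w, sub_add_cancel, G.proj_eq_self n _ hw]

theorem proj_smul_eq (G : GradedProj 𝒮 ℳ) {ε : Γ} {b : S} (hb : b ∈ 𝒮 ε) (n : Γ) (w : M) :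
    G.proj n (b • w) = b • G.proj (n - ε) w := by
  rw [← G.proj_smul ε (n - ε) b hb w, sub_add_cancel]

variable {𝒜 : Γ → AddSubgroup A}

/-- The quotient of a graded module by the multiples of a homogeneous element is graded. -/
def ofSurjective (G : GradedProj 𝒮 𝒜) {ε : Γ} {b : S} (hb : b ∈ 𝒮 ε) (π : A →ₗ[S] B)
    (hπ : Function.Surjective π) (hker : ∀ z, π z = 0 ↔ ∃ w, z = b • w) :
    GradedProj 𝒮 (fun n => (𝒜 n).map π.toAddMonoidHom) :=
  have hle : ∀ n, π.toAddMonoidHom.ker ≤ (π.toAddMonoidHom.comp (G.proj n)).ker := by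
    intro n z hz
    obtain ⟨w, rfl⟩ := (hker z).mp hz
    exact (hker _).mpr ⟨_, G.proj_smul_eq hb n w⟩
  let P : Γ → B →+ B := fun n => AddMonoidHom.liftOfSurjective π.toAddMonoidHom hπ
    ⟨π.toAddMonoidHom.comp (G.proj n), hle n⟩
  have hP : ∀ n z, P n (π z) = π (G.proj n z) := fun n z =>
    AddMonoidHom.liftOfRightInverse_comp_apply π.toAddMonoidHom _
      (Function.rightInverse_surjInv hπ) ⟨π.toAddMonoidHom.comp (G.proj n), hle n⟩ z
  { proj := P
    proj_mem := fun n y => by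
      obtain ⟨z, rfl⟩ := hπ y
      rw [hP]
      exact ⟨_, G.proj_mem n z, rfl⟩
    proj_eq_self := by
      rintro n _ ⟨z, hz, rfl⟩
      change P n (π z) = π z
      rw [hP, G.proj_eq_self n z hz]
    proj_smul := fun ε n y hy z => by
      obtain ⟨z, rfl⟩ := hπ z
      rw [← map_smul, hP, hP, G.proj_smul ε n y hy, map_smul]
    finite := fun z => by
      obtain ⟨z, rfl⟩ := hπ z
      obtain ⟨T, hT⟩ := G.finite z
      refine ⟨T, ?_⟩
      simp only [hP, ← map_sum]
      rw [← hT] }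

end GradedProj

theorem localizedModule_mk_eq_zero_iff {f : S} {z : M} {s : Submonoid.powers f} :
    (LocalizedModule.mk z s : LocalizedModule (Submonoid.powers f) M) = 0 ↔
      ∃ k : ℕ, f ^ k • z = 0 := by
  rw [IsLocalizedModule.mk_eq_mk', IsLocalizedModule.mk'_eq_zero']
  constructor
  · rintro ⟨⟨_, k, rfl⟩, hk⟩
    exact ⟨k, hk⟩
  · rintro ⟨k, hk⟩
    exact ⟨⟨f ^ k, k, rfl⟩, hk⟩

theorem mk_eq_mk_pow_smul {f : S} (z : M) (k j : ℕ) :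
    (LocalizedModule.mk z ⟨f ^ k, k, rfl⟩ : LocalizedModule (Submonoid.powers f) M) =
      LocalizedModule.mk (f ^ j • z) (⟨f ^ (k + j), k + j, rfl⟩ : Submonoid.powers f) := by
  rw [LocalizedModule.mk_eq]
  refine ⟨1, ?_⟩
  simp only [one_smul, Submonoid.smul_def, smul_smul, pow_add]

theorem pow_smul_mem {ℳ : Γ → AddSubgroup M} {f : S} {δ : Γ}
    (hf : ∀ n, ∀ z ∈ ℳ n, f • z ∈ ℳ (n + δ)) (j : ℕ) {n : Γ} {z : M} (hz : z ∈ ℳ n) :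
    f ^ j • z ∈ ℳ (n + j • δ) := by
  induction j with
  | zero => simpa using hz
  | succ j ih =>
    rw [pow_succ', mul_smul, succ_nsmul, ← add_assoc]
    exact hf _ _ ih

/-- Bringing fractions to a common denominator, every element of `[M_f]_n` is a single fraction. -/
theorem mem_locPiece_iff {ℳ : Γ → AddSubgroup M} {f : S} {δ : Γ}
    (hf : ∀ n, ∀ z ∈ ℳ n, f • z ∈ ℳ (n + δ)) {n : Γ}
    {y : LocalizedModule (Submonoid.powers f) M} :
    y ∈ locPiece ℳ f δ n ↔ ∃ k : ℕ, ∃ z ∈ ℳ (n + k • δ),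
      y = LocalizedModule.mk z (⟨f ^ k, k, rfl⟩ : Submonoid.powers f) := by
  refine ⟨fun h => ?_, fun h => AddSubgroup.subset_closure h⟩
  induction h using AddSubgroup.closure_induction with
  | mem y hy => exact hy
  | zero => exact ⟨0, 0, AddSubgroup.zero_mem _, (LocalizedModule.zero_mk _).symm⟩
  | add y y' _ _ h h' =>
    obtain ⟨k, z, hz, rfl⟩ := h
    obtain ⟨k', z', hz', rfl⟩ := h'
    refine ⟨k + k', f ^ k' • z + f ^ k • z', AddSubgroup.add_mem _ ?_ ?_, ?_⟩
    · rw [add_smul, ← add_assoc]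
      exact pow_smul_mem hf k' hz
    · rw [add_comm k, add_smul, ← add_assoc]
      exact pow_smul_mem hf k hz'
    · rw [LocalizedModule.mk_add_mk]
      congr 1
      exact Subtype.ext (pow_add f k k').symm
  | neg y _ h =>
    obtain ⟨k, z, hz, rfl⟩ := h
    exact ⟨k, -z, AddSubgroup.neg_mem _ hz, LocalizedModule.mk_neg.symm⟩

variable {𝒮 : Γ → AddSubgroup S} {x : Fin r → S} {δ : Fin r → Γ}

theorem GradedProj.mem_locPiece_iff {ℳ : Γ → AddSubgroup M} (G : GradedProj 𝒮 ℳ)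
    (hx : ∀ i, x i ∈ 𝒮 (δ i)) {σ : Finset (Fin r)} {n : Γ} {y : CechLoc x M σ} :
    y ∈ locPiece ℳ (∏ i ∈ σ, x i) (∑ i ∈ σ, δ i) n ↔ ∃ k : ℕ, ∃ z ∈ ℳ (n + k • ∑ i ∈ σ, δ i),
      y = LocalizedModule.mk z
        (⟨(∏ i ∈ σ, x i) ^ k, k, rfl⟩ : Submonoid.powers (∏ i ∈ σ, x i)) :=
  _root_.mem_locPiece_iff fun _ _ hz => G.prod_smul_mem hx σ hz

theorem cechRes_mem_locPiece {ℳ : Γ → AddSubgroup M} (G : GradedProj 𝒮 ℳ)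
    (hx : ∀ i, x i ∈ 𝒮 (δ i)) {σ τ : Finset (Fin r)} (h : σ ⊆ τ) {n : Γ} {y : CechLoc x M σ}
    (hy : y ∈ locPiece ℳ (∏ i ∈ σ, x i) (∑ i ∈ σ, δ i) n) :
    cechRes x M h y ∈ locPiece ℳ (∏ i ∈ τ, x i) (∑ i ∈ τ, δ i) n := by
  rw [G.mem_locPiece_iff hx] at hy ⊢
  obtain ⟨k, z, hz, rfl⟩ := hy
  refine ⟨k, _, ?_, cechRes_mk x h z k⟩
  rw [← Finset.sum_sdiff h, add_comm (∑ i ∈ τ \ σ, δ i), smul_add, ← add_assoc]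
  exact pow_smul_mem (fun _ _ hz => G.prod_smul_mem hx (τ \ σ) hz) k hz

theorem mem_cechStrand {ℳ : Γ → AddSubgroup M} {p : ℕ} {n : Γ} {c : CechCochain x M p} :
    c ∈ cechStrand ℳ x δ p n ↔
      ∀ σ, c σ ∈ locPiece ℳ (∏ i ∈ σ.1, x i) (∑ i ∈ σ.1, δ i) n := by
  simp [cechStrand, AddSubgroup.mem_pi]

theorem cechDiff_mem_cechStrand {ℳ : Γ → AddSubgroup M} (G : GradedProj 𝒮 ℳ)
    (hx : ∀ i, x i ∈ 𝒮 (δ i)) {p : ℕ} {n : Γ} {c : CechCochain x M p}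
    (hc : c ∈ cechStrand ℳ x δ p n) : cechDiff x M p c ∈ cechStrand ℳ x δ (p + 1) n := by
  rw [mem_cechStrand] at hc ⊢
  intro τ
  rw [cechDiff_apply]
  refine AddSubgroup.sum_mem _ fun j _ => ?_
  have h := cechRes_mem_locPiece G hx (Finset.erase_subset j.1 τ.1) (hc ⟨τ.1.erase j.1, by
    rw [Finset.card_erase_of_mem j.2, τ.2, Nat.add_sub_cancel]⟩)
  rcases neg_one_pow_eq_or S (τ.1.filter (· < j.1)).card with h1 | h1
  · rwa [h1, one_smul]
  · rw [h1, neg_smul, one_smul]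
    exact AddSubgroup.neg_mem _ h

theorem smul_mem_cechStrand {ℳ : Γ → AddSubgroup M} (G : GradedProj 𝒮 ℳ)
    (hx : ∀ i, x i ∈ 𝒮 (δ i)) {ε : Γ} {b : S} (hb : b ∈ 𝒮 ε) {p : ℕ} {n : Γ}
    {c : CechCochain x M p} (hc : c ∈ cechStrand ℳ x δ p (n - ε)) :
    b • c ∈ cechStrand ℳ x δ p n := by
  rw [mem_cechStrand] at hc ⊢
  intro σ
  obtain ⟨k, z, hz, hk⟩ := (G.mem_locPiece_iff hx).mp (hc σ)
  rw [Pi.smul_apply, hk, LocalizedModule.smul'_mk]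
  refine (G.mem_locPiece_iff hx).mpr ⟨k, b • z, ?_, rfl⟩
  have := G.smul_mem hb hz
  rwa [add_right_comm, sub_add_cancel] at this

variable {𝒜 : Γ → AddSubgroup A} (π : A →ₗ[S] B)

theorem map_cechStrand (p : ℕ) (n : Γ) :
    (cechStrand 𝒜 x δ p n).map (cechMap x π p).toAddMonoidHom =
      cechStrand (fun n => (𝒜 n).map π.toAddMonoidHom) x δ p n := by
  have hloc : ∀ σ : Finset (Fin r),
      locPiece (fun n => (𝒜 n).map π.toAddMonoidHom) (∏ i ∈ σ, x i) (∑ i ∈ σ, δ i) n =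
        (locPiece 𝒜 (∏ i ∈ σ, x i) (∑ i ∈ σ, δ i) n).map
          (cechLocMap x π σ).toAddMonoidHom := by
    intro σ
    rw [locPiece, locPiece, AddMonoidHom.map_closure]
    congr 1
    ext y
    constructor
    · rintro ⟨k, _, ⟨z, hz, rfl⟩, rfl⟩
      exact ⟨_, ⟨k, z, hz, rfl⟩, cechLocMap_mk x π σ z _⟩
    · rintro ⟨_, ⟨k, z, hz, rfl⟩, rfl⟩
      exact ⟨k, π z, ⟨z, hz, rfl⟩, cechLocMap_mk x π σ z _⟩
  ext c
  rw [mem_cechStrand]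
  constructor
  · rintro ⟨c, hc, rfl⟩ σ
    rw [hloc]
    exact ⟨c σ, mem_cechStrand.mp hc σ, rfl⟩
  · intro hc
    simp only [hloc] at hc
    choose c' hc' h using hc
    exact ⟨c', mem_cechStrand.mpr hc', funext h⟩

/-- If `ker π = bA` then the kernel of `π` on Čech cochains of degree `n` consists of the
`b`-multiples of cochains of degree `n - deg b`. -/
theorem exists_smul_eq_of_cechMap_eq_zero (G : GradedProj 𝒮 𝒜) (hx : ∀ i, x i ∈ 𝒮 (δ i)) {ε : Γ}
    {b : S} (hb : b ∈ 𝒮 ε) (hker : ∀ z, π z = 0 → ∃ w, z = b • w) {p : ℕ} {n : Γ}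
    {c : CechCochain x A p} (hc : c ∈ cechStrand 𝒜 x δ p n) (h0 : cechMap x π p c = 0) :
    ∃ u ∈ cechStrand 𝒜 x δ p (n - ε), c = b • u := by
  rw [mem_cechStrand] at hc
  have key : ∀ σ : {σ : Finset (Fin r) // σ.card = p},
      ∃ u ∈ locPiece 𝒜 (∏ i ∈ σ.1, x i) (∑ i ∈ σ.1, δ i) (n - ε), c σ = b • u := by
    intro σ
    obtain ⟨k, z, hz, hk⟩ := (G.mem_locPiece_iff hx).mp (hc σ)
    have h1 := congrFun h0 σ
    rw [cechMap_apply, hk, cechLocMap_mk, Pi.zero_apply, localizedModule_mk_eq_zero_iff] at h1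
    obtain ⟨j, hj⟩ := h1
    rw [← map_smul] at hj
    obtain ⟨w, hw⟩ := hker _ hj
    have hmem := pow_smul_mem (fun _ _ hz => G.prod_smul_mem hx σ.1 hz) j hz
    rw [hw, add_assoc, ← add_smul] at hmem
    obtain ⟨w', hw', hww'⟩ := G.exists_smul_eq hb hmem
    rw [add_sub_right_comm] at hw'
    refine ⟨_, (G.mem_locPiece_iff hx).mpr ⟨k + j, w', hw', rfl⟩, ?_⟩
    rw [hk, LocalizedModule.smul'_mk, mk_eq_mk_pow_smul z k j, hw, hww']
  choose u hu h using key
  exact ⟨u, mem_cechStrand.mpr hu, funext h⟩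

/-- If every element killed by `b` is killed by powers of the `xᵢ`, then `b` is injective on Čech
cochains of positive degree. -/
theorem eq_zero_of_smul_cechCochain_eq_zero {b : S}
    (htor : ∀ i, ∀ z : M, b • z = 0 → ∃ k : ℕ, x i ^ k • z = 0) {p : ℕ}
    {c : CechCochain x M (p + 1)} (h0 : b • c = 0) : c = 0 := by
  funext σ
  have h1 := congrFun h0 σ
  rw [Pi.smul_apply, Pi.zero_apply] at h1
  rw [Pi.zero_apply]
  generalize c σ = y at h1 ⊢
  induction y using LocalizedModule.induction_on with
  | h z f =>
    rw [LocalizedModule.smul'_mk, localizedModule_mk_eq_zero_iff] at h1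
    rw [localizedModule_mk_eq_zero_iff]
    obtain ⟨j, hj⟩ := h1
    obtain ⟨i, hi⟩ : σ.1.Nonempty := Finset.card_pos.mp (by rw [σ.2]; exact Nat.succ_pos p)
    rw [smul_comm] at hj
    obtain ⟨k, hk⟩ := htor i _ hj
    obtain ⟨g, hg⟩ := Finset.dvd_prod_of_mem x hi
    refine ⟨k + j, ?_⟩
    rw [pow_add, mul_smul]
    conv_lhs => rw [hg]
    rw [mul_pow, mul_comm, mul_smul, ← hg, hk, smul_zero]

theorem subsingleton_localCohomologyPiece_iff {ℳ : Γ → AddSubgroup M} {p : ℕ} {n : Γ} :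
    Subsingleton (LocalCohomologyPiece ℳ x δ p n) ↔
      cechCocycles ℳ x δ p n ≤ cechCoboundaries ℳ x δ p n := by
  rw [QuotientAddGroup.subsingleton_iff, AddSubgroup.addSubgroupOf_eq_top]

theorem map_cechCoboundaries_le (p : ℕ) (n : Γ) :
    (cechCoboundaries 𝒜 x δ p n).map (cechMap x π p).toAddMonoidHom ≤
      cechCoboundaries (fun n => (𝒜 n).map π.toAddMonoidHom) x δ p n := by
  cases p with
  | zero =>
    rintro _ ⟨c, hc, rfl⟩
    rw [show c = 0 from hc]
    exact (map_zero (cechMap x π 0)) ▸ AddSubgroup.zero_mem _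
  | succ p =>
    rintro _ ⟨_, ⟨c, hc, rfl⟩, rfl⟩
    refine ⟨cechMap x π p c, ?_, (cechMap_cechDiff x π p c).symm⟩
    rw [← map_cechStrand]
    exact ⟨c, hc, rfl⟩

/-- Cohomology of `B` in degree `(p, n)` vanishes with that of `A`, as soon as every lift to `A` of
a cocycle of `B` can be corrected to a cocycle by a cochain that `π` kills. -/
theorem cechCocycles_le_of_correction {p : ℕ} {n : Γ}
    (hA : cechCocycles 𝒜 x δ p n ≤ cechCoboundaries 𝒜 x δ p n)
    (hcor : ∀ c ∈ cechStrand 𝒜 x δ p n, cechDiff x B p (cechMap x π p c) = 0 →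
      ∃ v ∈ cechStrand 𝒜 x δ p n, cechMap x π p v = 0 ∧ cechDiff x A p c = cechDiff x A p v) :
    cechCocycles (fun n => (𝒜 n).map π.toAddMonoidHom) x δ p n ≤
      cechCoboundaries (fun n => (𝒜 n).map π.toAddMonoidHom) x δ p n := by
  rintro _ ⟨hc, hd⟩
  rw [← map_cechStrand] at hc
  obtain ⟨c, hc, rfl⟩ := hc
  obtain ⟨v, hv, hv0, hcv⟩ := hcor c hc hd
  refine map_cechCoboundaries_le π p n ⟨c - v, hA ⟨AddSubgroup.sub_mem _ hc hv, ?_⟩, ?_⟩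
  · change cechDiff x A p (c - v) = 0
    rw [map_sub, hcv, sub_self]
  · change cechMap x π p (c - v) = cechMap x π p c
    rw [map_sub, hv0, sub_zero]

theorem cechCocycles_le_of_injective (G : GradedProj 𝒮 𝒜) (hx : ∀ i, x i ∈ 𝒮 (δ i))
    (hinj : ∀ z, π z = 0 → z = 0) {p : ℕ} {n : Γ}
    (hA : cechCocycles 𝒜 x δ p n ≤ cechCoboundaries 𝒜 x δ p n) :
    cechCocycles (fun n => (𝒜 n).map π.toAddMonoidHom) x δ p n ≤
      cechCoboundaries (fun n => (𝒜 n).map π.toAddMonoidHom) x δ p n := by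
  refine cechCocycles_le_of_correction π hA fun c hc hd =>
    ⟨0, AddSubgroup.zero_mem _, map_zero _, ?_⟩
  rw [← cechMap_cechDiff] at hd
  obtain ⟨u, -, hu⟩ := exists_smul_eq_of_cechMap_eq_zero π G hx (b := 0) (ε := 0)
    (AddSubgroup.zero_mem _) (fun z hz => ⟨0, by rw [hinj z hz, smul_zero]⟩)
    (cechDiff_mem_cechStrand G hx hc) hd
  rw [hu, zero_smul, map_zero]

/-- The connecting map of `0 → (A / (0 : b))(-ε) → A → A / bA → 0`, done by hand: if
`[H^p(A)]_n` and `[H^{p+1}(A)]_{n-ε}` vanish, then so does `[H^p(A / bA)]_n`.  The torsion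
hypothesis says that `(0 : b)` does not contribute to cohomology in positive degrees. -/
theorem cechCocycles_le_of_ker_eq_smul (G : GradedProj 𝒮 𝒜) (hx : ∀ i, x i ∈ 𝒮 (δ i)) {ε : Γ}
    {b : S} (hb : b ∈ 𝒮 ε) (hker : ∀ z, π z = 0 ↔ ∃ w, z = b • w)
    (htor : ∀ i, ∀ z : A, b • z = 0 → ∃ k : ℕ, x i ^ k • z = 0) {p : ℕ} {n : Γ}
    (hA : cechCocycles 𝒜 x δ p n ≤ cechCoboundaries 𝒜 x δ p n)
    (hA' : cechCocycles 𝒜 x δ (p + 1) (n - ε) ≤ cechCoboundaries 𝒜 x δ (p + 1) (n - ε)) :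
    cechCocycles (fun n => (𝒜 n).map π.toAddMonoidHom) x δ p n ≤
      cechCoboundaries (fun n => (𝒜 n).map π.toAddMonoidHom) x δ p n := by
  refine cechCocycles_le_of_correction π hA fun c hc hd => ?_
  rw [← cechMap_cechDiff] at hd
  obtain ⟨u, hu, hcu⟩ := exists_smul_eq_of_cechMap_eq_zero π G hx hb (fun z => (hker z).mp)
    (cechDiff_mem_cechStrand G hx hc) hd
  -- `u` represents the image of the class under the connecting map.
  have hdu : cechDiff x A (p + 1) u = 0 := by
    refine eq_zero_of_smul_cechCochain_eq_zero htor ?_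
    rw [← map_smul, ← hcu, cechDiff_cechDiff]
  obtain ⟨v, hv, hvu⟩ := hA' ⟨hu, hdu⟩
  refine ⟨b • v, smul_mem_cechStrand G hx hb hv, ?_, ?_⟩
  · funext σ
    rw [cechMap_apply, Pi.smul_apply, Pi.zero_apply]
    generalize v σ = y
    induction y using LocalizedModule.induction_on with
    | h z f =>
      rw [LocalizedModule.smul'_mk, cechLocMap_mk, (hker _).mpr ⟨z, rfl⟩, LocalizedModule.zero_mk]
  · rw [hcu, map_smul, ← hvu]
    rfl

/-- Vanishing of `[H^0(M)]_n` means that `M_n` has no torsion with respect to `x₁, …, xᵣ`. -/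
theorem eq_zero_of_torsion {ℳ : Γ → AddSubgroup M} {n : Γ}
    (h : cechCocycles ℳ x δ 0 n ≤ cechCoboundaries ℳ x δ 0 n) {z : M} (hz : z ∈ ℳ n)
    (htor : ∀ i, ∃ k : ℕ, x i ^ k • z = 0) : z = 0 := by
  let c : CechCochain x M 0 := fun σ => LocalizedModule.mkLinearMap _ M z
  have hc : c ∈ cechCocycles ℳ x δ 0 n := by
    refine ⟨mem_cechStrand.mpr fun σ => AddSubgroup.subset_closure ⟨0, z, by simpa using hz, ?_⟩,
      ?_⟩
    · change LocalizedModule.mk z 1 = _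
      congr 1
      exact Subtype.ext (pow_zero _).symm
    · funext τ
      rw [Pi.zero_apply, cechDiff_apply]
      refine Finset.sum_eq_zero fun j _ => ?_
      rw [cechRes_mkLinearMap]
      obtain ⟨k, hk⟩ := htor j.1
      obtain ⟨g, hg⟩ := Finset.dvd_prod_of_mem x j.2
      have : (LocalizedModule.mkLinearMap (Submonoid.powers (∏ i ∈ τ.1, x i)) M) z = 0 := by
        refine localizedModule_mk_eq_zero_iff.mpr ⟨k, ?_⟩
        rw [hg, mul_pow, mul_comm, mul_smul, hk, smul_zero]
      rw [this, smul_zero]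
  have h0 : c = 0 := h hc
  obtain ⟨k, hk⟩ := localizedModule_mk_eq_zero_iff.mp (congrFun h0 ⟨∅, rfl⟩)
  rwa [Finset.prod_empty, one_pow, one_smul] at hk

end GradedCech

/-! ### Hyry's condition modulo a filter-regular sequence -/

section FilterRegular

variable {s : ℕ} {S : Type*} [CommRing S] {r : ℕ} {M : Type*} [AddCommGroup M] [Module S M]
  {𝒮 : (Fin s → ℤ) → AddSubgroup S} {ℳ : (Fin s → ℤ) → AddSubgroup M}
  {x : Fin r → S} {δ : Fin r → Fin s → ℤ}

theorem exists_le_add_nsmul {δ : Fin s → ℤ} (hδ : 1 ≤ δ) (n N : Fin s → ℤ) :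
    ∃ k : ℕ, N ≤ n + k • δ := by
  refine ⟨∑ i, (N i - n i).toNat, fun i => ?_⟩
  have h1 : (N i - n i).toNat ≤ ∑ j, (N j - n j).toNat :=
    Finset.single_le_sum (f := fun j => (N j - n j).toNat) (fun _ _ => Nat.zero_le _)
      (Finset.mem_univ i)
  have h2 : 1 ≤ δ i := hδ i
  change N i ≤ n i + (∑ j, (N j - n j).toNat) • δ i
  generalize ∑ j, (N j - n j).toNat = K at h1 ⊢
  have h3 : (K : ℤ) * 1 ≤ K * δ i := mul_le_mul_of_nonneg_left h2 (Int.natCast_nonneg K)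
  rw [nsmul_eq_mul]
  omega

/-- A graded submodule `K` that vanishes in high degrees is torsion with respect to each `y` of
degree at least `(1, …, 1)`, as powers of `y` push homogeneous elements into high degrees. -/
theorem exists_pow_smul_eq_zero (G : GradedProj 𝒮 ℳ) {δ : Fin s → ℤ} {y : S} (hy : y ∈ 𝒮 δ)
    (hδ : y = 0 ∨ 1 ≤ δ) (K : Submodule S M) (hK : ∀ n, ∀ z ∈ K, G.proj n z ∈ K)
    (N : Fin s → ℤ) (hN : ∀ n, N ≤ n → ∀ z ∈ ℳ n, z ∈ K → z = 0) {z : M} (hz : z ∈ K) :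
    ∃ k : ℕ, y ^ k • z = 0 := by
  -- A zero element is homogeneous of every degree, so this case is not covered by the other one.
  rcases hδ with rfl | hδ
  · exact ⟨1, by rw [pow_one, zero_smul]⟩
  have key : ∀ n, ∃ k : ℕ, y ^ k • G.proj n z = 0 := by
    intro n
    obtain ⟨k, hk⟩ := exists_le_add_nsmul hδ n N
    exact ⟨k, hN _ hk _ (pow_smul_mem (fun _ _ h => G.smul_mem hy h) k (G.proj_mem n z))
      (K.smul_mem _ (hK n z hz))⟩
  choose k hk using key
  obtain ⟨T, hT⟩ := G.finite z
  refine ⟨∑ n ∈ T, k n, ?_⟩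
  conv_lhs => rw [hT, Finset.smul_sum]
  refine Finset.sum_eq_zero fun n hn => ?_
  rw [← Finset.sum_erase_add _ _ hn, pow_add, mul_smul, hk, smul_zero]

theorem exists_pow_smul_eq_zero_of_isFilterRegular (G : GradedProj 𝒮 ℳ) {δ ε : Fin s → ℤ}
    {y b : S} (hy : y ∈ 𝒮 δ) (hδ : y = 0 ∨ 1 ≤ δ) (hb : b ∈ 𝒮 ε) (hreg : IsFilterRegular ℳ b)
    {z : M} (hz : b • z = 0) : ∃ k : ℕ, y ^ k • z = 0 := by
  obtain ⟨N, hN⟩ := hreg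
  refine exists_pow_smul_eq_zero G hy hδ (LinearMap.ker (LinearMap.lsmul S M b)) ?_ N hN hz
  intro n z hz
  change b • G.proj n z = 0
  rw [← G.proj_smul ε n b hb z, show b • z = 0 from hz, map_zero]

open scoped Pointwise in
/-- Passing to the quotient by a homogeneous filter-regular sequence preserves the vanishing of
local cohomology, at the cost of raising the bound by the degrees of the sequence. -/
theorem cechCocycles_le_of_isFilterRegularSeq {ι : Type*} (l : List ι) (b : ι → S)
    (e : ι → Fin s → ℤ) (hb : ∀ i ∈ l, b i ∈ 𝒮 (e i)) (he : ∀ i ∈ l, 0 ≤ e i) (G : GradedProj 𝒮 ℳ)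
    (hx : ∀ i, x i ∈ 𝒮 (δ i)) (hδ : ∀ i, x i = 0 ∨ 1 ≤ δ i)
    (hreg : IsFilterRegularSeq ℳ (l.map b)) {m : Fin s → ℤ}
    (hm : ∀ p n, m ≤ n → cechCocycles ℳ x δ p n ≤ cechCoboundaries ℳ x δ p n) (k : ℕ)
    (hk : k ≤ l.length) :
    Nonempty (GradedProj 𝒮 fun n => (ℳ n).map
      (Submodule.mkQ (Ideal.ofList ((l.map b).take k) • (⊤ : Submodule S M))).toAddMonoidHom) ∧
    ∀ p n, m + ((l.take k).map e).sum ≤ n →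
      cechCocycles (fun n => (ℳ n).map (Submodule.mkQ
        (Ideal.ofList ((l.map b).take k) • (⊤ : Submodule S M))).toAddMonoidHom) x δ p n ≤
      cechCoboundaries (fun n => (ℳ n).map (Submodule.mkQ
        (Ideal.ofList ((l.map b).take k) • (⊤ : Submodule S M))).toAddMonoidHom) x δ p n := by
  induction k with
  | zero =>
    -- `M / 0` is isomorphic, but not equal, to `M`.
    have hinj : ∀ z, (Submodule.mkQ
        (Ideal.ofList ((l.map b).take 0) • (⊤ : Submodule S M))) z = 0 → z = 0 := by
      intro z hz
      rw [Submodule.mkQ_apply, Submodule.Quotient.mk_eq_zero, List.take_zero, Ideal.ofList_nil,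
        Submodule.bot_smul] at hz
      exact hz
    refine ⟨⟨G.ofSurjective (b := 0) (ε := 0) (AddSubgroup.zero_mem _) _
      (Submodule.mkQ_surjective _) fun z => ⟨fun h => ⟨0, by rw [hinj z h, smul_zero]⟩, ?_⟩⟩, ?_⟩
    · rintro ⟨w, rfl⟩
      rw [zero_smul, map_zero]
    · intro p n hn
      rw [List.take_zero, List.map_nil, List.sum_nil, add_zero] at hn
      exact cechCocycles_le_of_injective _ G hx hinj (hm p n hn)
  | succ k ih =>
    obtain ⟨⟨G'⟩, hA⟩ := ih (Nat.le_of_succ_le hk)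
    have hk' : k < (l.map b).length := by rw [List.length_map]; exact hk
    have htake : (l.map b).take (k + 1) = (l.map b).take k ++ [(l.map b)[k]] :=
      (List.take_concat_get' _ k hk').symm
    have hbk : (l.map b)[k] ∈ 𝒮 (e l[k]) := by
      rw [List.getElem_map]
      exact hb _ (List.getElem_mem _)
    have hsup : Ideal.ofList ((l.map b).take (k + 1)) • (⊤ : Submodule S M) =
        Ideal.ofList ((l.map b).take k) • (⊤ : Submodule S M) ⊔
          (l.map b)[k] • (⊤ : Submodule S M) := by
      rw [htake, Ideal.ofList_append, Submodule.sup_smul, Ideal.ofList_singleton,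
        Submodule.ideal_span_singleton_smul]
    have hreg' := hreg k hk'
    generalize (l.map b)[k] = β at hbk hsup hreg'
    generalize Ideal.ofList ((l.map b).take (k + 1)) • (⊤ : Submodule S M) = N' at hsup ⊢
    generalize Ideal.ofList ((l.map b).take k) • (⊤ : Submodule S M) = N at *
    have hle : N ≤ N' := hsup ▸ le_sup_left
    have hmap : (fun n => (ℳ n).map N'.mkQ.toAddMonoidHom) =
        fun n => ((ℳ n).map N.mkQ.toAddMonoidHom).map
          (Submodule.factor hle).toAddMonoidHom := by
      funext n
      rw [AddSubgroup.map_map]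
      rfl
    have hker : ∀ z, Submodule.factor hle z = 0 ↔ ∃ w, z = β • w := by
      intro z
      obtain ⟨z, rfl⟩ := N.mkQ_surjective z
      rw [show Submodule.factor hle (N.mkQ z) = N'.mkQ z from rfl, Submodule.mkQ_apply,
        Submodule.Quotient.mk_eq_zero, hsup, Submodule.mem_sup]
      constructor
      · rintro ⟨y, hy, _, ⟨w, -, rfl⟩, rfl⟩
        refine ⟨N.mkQ w, ?_⟩
        rw [map_add, show N.mkQ y = 0 from (Submodule.Quotient.mk_eq_zero N).mpr hy, zero_add]
        rfl
      · rintro ⟨w, hw⟩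
        obtain ⟨w, rfl⟩ := N.mkQ_surjective w
        refine ⟨z - β • w, ?_, β • w, ⟨w, trivial, rfl⟩, sub_add_cancel _ _⟩
        rw [← Submodule.Quotient.mk_eq_zero, Submodule.Quotient.mk_sub]
        exact sub_eq_zero.mpr hw
    rw [hmap]
    refine ⟨⟨G'.ofSurjective hbk _ (Submodule.factor_surjective hle) hker⟩, ?_⟩
    intro p n hn
    rw [← List.take_concat_get' l k hk, List.map_append, List.sum_append, List.map_singleton,
      List.sum_singleton, ← add_assoc] at hn
    have hn' := (le_add_of_nonneg_right (he l[k] (List.getElem_mem _))).trans hn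
    exact cechCocycles_le_of_ker_eq_smul _ G' hx hbk hker
      (fun i z hz => exists_pow_smul_eq_zero_of_isFilterRegular G' (hx i) (hδ i) hbk hreg' hz)
      (hA p n hn') (hA (p + 1) _ (le_sub_iff_add_le.mpr hn))

/-- If moreover the quotient by the sequence vanishes in high degrees, it is torsion and hence
equal to its zeroth local cohomology, so it vanishes in all degrees allowed by the bound. -/
theorem mem_smul_top_of_isFilterRegularSeq {ι : Type*} (l : List ι) (b : ι → S)
    (e : ι → Fin s → ℤ) (hb : ∀ i ∈ l, b i ∈ 𝒮 (e i)) (he : ∀ i ∈ l, 0 ≤ e i)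
    (G : GradedProj 𝒮 ℳ) (hx : ∀ i, x i ∈ 𝒮 (δ i)) (hδ : ∀ i, x i = 0 ∨ 1 ≤ δ i)
    (hreg : IsFilterRegularSeq ℳ (l.map b)) {m : Fin s → ℤ}
    (hm : ∀ p n, m ≤ n → cechCocycles ℳ x δ p n ≤ cechCoboundaries ℳ x δ p n)
    (N : Fin s → ℤ)
    (hN : ∀ n, N ≤ n → ∀ z ∈ ℳ n, z ∈ Ideal.ofList (l.map b) • (⊤ : Submodule S M))
    {n : Fin s → ℤ} (hn : m + (l.map e).sum ≤ n) {z : M} (hz : z ∈ ℳ n) :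
    z ∈ Ideal.ofList (l.map b) • (⊤ : Submodule S M) := by
  obtain ⟨⟨G'⟩, h⟩ :=
    cechCocycles_le_of_isFilterRegularSeq l b e hb he G hx hδ hreg hm l.length le_rfl
  rw [List.take_length] at h
  rw [List.take_of_length_le (by rw [List.length_map])] at h G'
  refine (Submodule.Quotient.mk_eq_zero _).mp (eq_zero_of_torsion (h 0 n hn) ⟨z, hz, rfl⟩ ?_)
  intro i
  refine exists_pow_smul_eq_zero G' (hx i) (hδ i) ⊤ (fun _ _ _ => trivial) N ?_ trivial
  rintro k hk _ ⟨y, hy, rfl⟩ -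
  exact (Submodule.Quotient.mk_eq_zero _).mpr (hN k hk y hy)

end FilterRegular

/-! ### The gradings of `G(I)` and `G(F)` -/

section Assoc

variable {R : Type*} [CommRing R] {s : ℕ}

namespace MLaurent

theorem ext_coeff {f g : MLaurent R s} (h : ∀ n, f.coeff n = g.coeff n) : f = g :=
  AddMonoidAlgebra.coeff_injective (Finsupp.ext h)

theorem coeff_single_self (n : Fin s → ℤ) (c : R) : (single n c).coeff n = c := by
  classical
  change (AddMonoidAlgebra.coeff (AddMonoidAlgebra.single n c)) n = c
  rw [AddMonoidAlgebra.coeff_single, Finsupp.single_eq_same]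

theorem coeff_single_of_ne {n k : Fin s → ℤ} (h : k ≠ n) (c : R) : (single n c).coeff k = 0 := by
  classical
  change (AddMonoidAlgebra.coeff (AddMonoidAlgebra.single n c)) k = 0
  rw [AddMonoidAlgebra.coeff_single, Finsupp.single_eq_of_ne h]

theorem single_add (n : Fin s → ℤ) (c c' : R) : single n (c + c') = single n c + single n c' :=
  AddMonoidAlgebra.single_add n c c'

theorem single_zero (n : Fin s → ℤ) : single n (0 : R) = 0 :=
  AddMonoidAlgebra.single_zero n

theorem single_mul_single (m n : Fin s → ℤ) (c c' : R) :
    single m c * single n c' = single (m + n) (c * c') :=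
  AddMonoidAlgebra.single_mul_single ..

theorem coeff_single_mul (m n : Fin s → ℤ) (c : R) (f : MLaurent R s) :
    (single m c * f).coeff n = c * f.coeff (n - m) :=
  AddMonoidAlgebra.coeff_single_mul_eq_mul_coeff (R := R) (x := f) (n - m)
    fun _ _ => eq_sub_iff_add_eq'.symm

theorem eq_single {f : MLaurent R s} {n : Fin s → ℤ} (h : ∀ k, k ≠ n → f.coeff k = 0) :
    f = single n (f.coeff n) := by
  refine ext_coeff fun k => ?_
  rcases eq_or_ne k n with rfl | hk
  · rw [coeff_single_self]
  · rw [h k hk, coeff_single_of_ne hk]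

theorem eq_sum_single (f : MLaurent R s) :
    f = ∑ n ∈ (AddMonoidAlgebra.coeff f).support, single n (f.coeff n) :=
  (AddMonoidAlgebra.sum_coeff_single f).symm

end MLaurent

theorem natPart_of_nonneg (A : (Fin s → ℤ) → Ideal R) {n : Fin s → ℤ} (h : 0 ≤ n) :
    natPart A n = A n := if_pos h

theorem natPart_of_not_nonneg (A : (Fin s → ℤ) → Ideal R) {n : Fin s → ℤ} (h : ¬0 ≤ n) :
    natPart A n = ⊥ := if_neg h

theorem natPart_le (A : (Fin s → ℤ) → Ideal R) (n : Fin s → ℤ) : natPart A n ≤ A n := by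
  unfold natPart
  split_ifs
  · exact le_rfl
  · exact bot_le

variable {I : Fin s → Ideal R}

/-- A representative in `ℛ(I)` of an element of `G(I)₊₊` has, in each degree that is not at least
`(1, …, 1)`, a coefficient that vanishes in `G(I)`. -/
theorem coeff_mem_of_mem_plusPlusIdeal {w : AssocRing I}
    (hw : w ∈ plusPlusIdeal (assocRingPiece I)) :
    ∀ g : reesRing I, AssocRing.mk I g = w → ∀ n, 0 ≤ n → ¬ 1 ≤ n →
      (g : MLaurent R s).coeff n ∈ idealPow I (n + 1) := by
  -- The condition on the coefficient depends only on the class in `G(I)`.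
  have key : ∀ (g g' : reesRing I), AssocRing.mk I g = AssocRing.mk I g' → ∀ n, 0 ≤ n →
      (g' : MLaurent R s).coeff n ∈ idealPow I (n + 1) →
      (g : MLaurent R s).coeff n ∈ idealPow I (n + 1) := by
    intro g g' h n hn hg'
    have h1 : g - g' ∈ reesShiftIdeal I := Ideal.Quotient.eq.mp h
    have h2 : ((g - g' : reesRing I) : MLaurent R s).coeff n ∈ _ := natPart_le _ n (h1 n)
    have h3 := Ideal.add_mem _ h2 hg'
    rwa [← MLaurent.coeff_add, ← Subalgebra.coe_add, sub_add_cancel] at h3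
  refine Submodule.span_induction ?_ ?_ ?_ ?_ hw
  · rintro _ ⟨k, hk, f, hf, rfl⟩ g hg n hn hn1
    refine key g f hg n hn ?_
    rw [hf n (fun h => hn1 (h ▸ hk))]
    exact Ideal.zero_mem _
  · intro g hg n hn _
    refine key g 0 (by rw [hg, map_zero]) n hn ?_
    exact Ideal.zero_mem _
  · intro y y' _ _ h h' g hg n hn hn1
    obtain ⟨f, rfl⟩ := Ideal.Quotient.mk_surjective y
    obtain ⟨f', rfl⟩ := Ideal.Quotient.mk_surjective y'
    refine key g (f + f') hg n hn ?_
    exact Ideal.add_mem _ (h f rfl n hn hn1) (h' f' rfl n hn hn1)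
  · intro c y _ h g hg n hn hn1
    obtain ⟨f, rfl⟩ := Ideal.Quotient.mk_surjective y
    obtain ⟨c, rfl⟩ := Ideal.Quotient.mk_surjective c
    refine key g (c * f) hg n hn ?_
    rw [Subalgebra.coe_mul, MLaurent.coeff_mul]
    refine Ideal.sum_mem _ fun m₁ _ => Ideal.sum_mem _ fun m₂ _ => ?_
    split_ifs with hmn
    · by_cases h1 : 0 ≤ m₁
      · by_cases h2 : 0 ≤ m₂
        · have hm2 : m₂ ≤ n := hmn ▸ le_add_of_nonneg_left h1
          have hc := natPart_le _ m₁ (c.2 m₁)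
          have hy := h f rfl m₂ h2 fun h3 => hn1 (h3.trans hm2)
          rw [← hmn, add_assoc]
          exact idealPow_mul_le I _ _ (Ideal.mul_mem_mul hc hy)
        · have hy := f.2 m₂
          rw [natPart_of_not_nonneg _ h2] at hy
          rw [show (f : MLaurent R s).coeff m₂ = 0 from hy, mul_zero]
          exact Ideal.zero_mem _
      · have hc := c.2 m₁
        rw [natPart_of_not_nonneg _ h1] at hc
        rw [show (c : MLaurent R s).coeff m₁ = 0 from hc, zero_mul]
        exact Ideal.zero_mem _
    · exact Ideal.zero_mem _

/-- As `G(I)` is `ℕ^s`-graded, `G(I)₊₊` lives in degrees at least `(1, …, 1)`. -/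
theorem eq_zero_or_one_le_of_mem_plusPlusIdeal {w : AssocRing I} {δ : Fin s → ℤ}
    (hw : w ∈ plusPlusIdeal (assocRingPiece I)) (hδ : w ∈ assocRingPiece I δ) :
    w = 0 ∨ 1 ≤ δ := by
  refine or_iff_not_imp_right.mpr fun h1 => ?_
  obtain ⟨g, hg, rfl⟩ := hδ
  refine Ideal.Quotient.eq_zero_iff_mem.mpr fun n => ?_
  rcases eq_or_ne n δ with rfl | hn
  · by_cases h0 : 0 ≤ n
    · rw [natPart_of_nonneg _ h0]
      exact coeff_mem_of_mem_plusPlusIdeal hw g rfl n h0 h1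
    · have h2 := g.2 n
      rw [natPart_of_not_nonneg _ h0] at h2 ⊢
      exact h2
  · rw [hg n hn]
    exact Ideal.zero_mem _

namespace MultiFiltration

variable (F : MultiFiltration I)

theorem assocMk_surjective : Function.Surjective F.assocMk := Submodule.mkQ_surjective _

theorem mk_smul_assocMk (g : reesRing I) (f : F.reesModule) :
    AssocRing.mk I g • F.assocMk f = F.assocMk (g • f) := rfl

theorem coe_smul_reesModule (g : reesRing I) (f : F.reesModule) :
    ((g • f : F.reesModule) : MLaurent R s) = (g : MLaurent R s) * (f : MLaurent R s) := rfl

theorem assocMk_eq_zero_iff {f : F.reesModule} :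
    F.assocMk f = 0 ↔ ∀ n, (f : MLaurent R s).coeff n ∈ natPart (fun n => F (n + 1)) n :=
  Submodule.Quotient.mk_eq_zero F.reesShift

/-- The projection of `ℛ(F)` to its component of degree `n`. -/
def component (n : Fin s → ℤ) : F.reesModule →+ F.reesModule where
  toFun f := ⟨MLaurent.single n ((f : MLaurent R s).coeff n), single_mem_coeffIn (f.2 n)⟩
  map_zero' := Subtype.ext (MLaurent.single_zero n)
  map_add' _ _ := Subtype.ext (MLaurent.single_add n _ _)

theorem coe_component (n : Fin s → ℤ) (f : F.reesModule) :
    (F.component n f : MLaurent R s) = MLaurent.single n ((f : MLaurent R s).coeff n) := rfl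

theorem ker_assocMk_le (n : Fin s → ℤ) : F.assocMk.toAddMonoidHom.ker ≤
    (F.assocMk.toAddMonoidHom.comp (F.component n)).ker := by
  intro f hf
  refine F.assocMk_eq_zero_iff.mpr fun k => ?_
  rw [coe_component]
  rcases eq_or_ne k n with rfl | hk
  · rw [MLaurent.coeff_single_self]
    exact F.assocMk_eq_zero_iff.mp hf k
  · rw [MLaurent.coeff_single_of_ne hk]
    exact Ideal.zero_mem _

/-- The projection of `G(F)` to its component of degree `n`. -/
def assocProj (n : Fin s → ℤ) : F.Assoc →+ F.Assoc :=
  AddMonoidHom.liftOfSurjective F.assocMk.toAddMonoidHom F.assocMk_surjective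
    ⟨F.assocMk.toAddMonoidHom.comp (F.component n), F.ker_assocMk_le n⟩

theorem assocProj_assocMk (n : Fin s → ℤ) (f : F.reesModule) :
    F.assocProj n (F.assocMk f) = F.assocMk (F.component n f) :=
  AddMonoidHom.liftOfRightInverse_comp_apply F.assocMk.toAddMonoidHom _
    (Function.rightInverse_surjInv F.assocMk_surjective)
    ⟨F.assocMk.toAddMonoidHom.comp (F.component n), F.ker_assocMk_le n⟩ f

/-- `G(F)` is a graded `G(I)`-module. -/
def gradedProj : GradedProj (assocRingPiece I) F.assocPiece where
  proj := F.assocProj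
  proj_mem n z := by
    obtain ⟨f, rfl⟩ := F.assocMk_surjective z
    rw [assocProj_assocMk]
    exact ⟨_, fun k hk => MLaurent.coeff_single_of_ne hk _, rfl⟩
  proj_eq_self := by
    rintro n _ ⟨f, hf, rfl⟩
    refine (F.assocProj_assocMk n f).trans (congrArg F.assocMk (Subtype.ext ?_))
    exact (MLaurent.eq_single hf).symm
  proj_smul := by
    rintro ε n _ ⟨g, hg, rfl⟩ z
    obtain ⟨f, rfl⟩ := F.assocMk_surjective z
    rw [assocProj_assocMk]
    change F.assocProj (n + ε) (F.assocMk (g • f)) = F.assocMk (g • F.component n f)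
    rw [assocProj_assocMk]
    refine congrArg F.assocMk (Subtype.ext ?_)
    rw [coe_component, coe_smul_reesModule, coe_smul_reesModule, coe_component,
      MLaurent.eq_single hg, MLaurent.coeff_single_mul, MLaurent.single_mul_single,
      add_sub_cancel_right, add_comm ε]
  finite z := by
    obtain ⟨f, rfl⟩ := F.assocMk_surjective z
    refine ⟨(AddMonoidAlgebra.coeff (f : MLaurent R s)).support, ?_⟩
    simp only [assocProj_assocMk, ← map_sum]
    refine congrArg F.assocMk (Subtype.ext ?_)
    rw [AddSubmonoidClass.coe_finsetSum]
    exact MLaurent.eq_sum_single _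

end MultiFiltration

end Assoc

/-! ### Joint reductions and the associated graded module -/

section JointReduction

variable {R : Type*} [CommRing R] {s : ℕ} {I : Fin s → Ideal R}

theorem initialForm_mem_assocRingPiece (i : Fin s) (a : I i) :
    initialForm I i a ∈ assocRingPiece I (Pi.single i 1) :=
  ⟨_, fun _ hk => MLaurent.coeff_single_of_ne hk _, rfl⟩

/-- The index set `{(i, j)}` of a joint reduction, listed lexicographically. -/
def jointIndexList (q : Fin s → ℕ) : List (Σ i, Fin (q i)) :=
  (List.ofFn fun i => List.ofFn fun j : Fin (q i) => (⟨i, j⟩ : Σ i, Fin (q i))).flatten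

theorem map_jointIndexList {α : Type*} {q : Fin s → ℕ} (f : (i : Fin s) → Fin (q i) → α) :
    (jointIndexList q).map (fun t => f t.1 t.2) =
      (List.ofFn fun i => List.ofFn fun j => f i j).flatten := by
  simp only [jointIndexList, List.map_flatten, List.map_ofFn, Function.comp_def]

theorem mem_jointIndexList {q : Fin s → ℕ} (t : Σ i, Fin (q i)) : t ∈ jointIndexList q := by
  obtain ⟨i, j⟩ := t
  refine List.mem_flatten.mpr ⟨_, (List.mem_ofFn' _ _).mpr ⟨i, rfl⟩, ?_⟩
  exact (List.mem_ofFn' _ _).mpr ⟨j, rfl⟩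

theorem sum_degree_jointIndexList (q : Fin s → ℕ) :
    ((jointIndexList q).map fun t => (Pi.single t.1 1 : Fin s → ℤ)).sum = fun i => (q i : ℤ) := by
  rw [map_jointIndexList (fun i (_ : Fin (q i)) => (Pi.single i 1 : Fin s → ℤ)), List.sum_flatten,
    List.map_ofFn, List.sum_ofFn]
  funext k
  simp only [Function.comp_apply, List.sum_ofFn, Finset.sum_const, Finset.card_univ,
    Fintype.card_fin, Finset.sum_apply]
  rw [Finset.sum_eq_single k]
  · rw [Pi.smul_apply, Pi.single_eq_same, nsmul_eq_mul, mul_one]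
  · intro i _ hi
    rw [Pi.smul_apply, Pi.single_eq_of_ne hi.symm, smul_zero]
  · exact fun h => absurd (Finset.mem_univ k) h

/-- Every element of `(b₁, …, bₗ) M` is a sum of elements `bᵢ • w`: an induction principle without
closure of `P` under scalars. -/
theorem smul_top_induction {S M : Type*} [CommRing S] [AddCommGroup M] [Module S M] {l : List S}
    {P : M → Prop} (zero : P 0) (add : ∀ w w', P w → P w' → P (w + w'))
    (smul : ∀ b ∈ l, ∀ w, P (b • w)) {w : M} (hw : w ∈ Ideal.ofList l • (⊤ : Submodule S M)) :
    P w := by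
  refine Submodule.smul_induction_on hw (fun c hc w _ => ?_) add
  suffices h : ∀ w, P (c • w) from h w
  refine Submodule.span_induction (p := fun c _ => ∀ w, P (c • w)) (fun b hb => smul b hb) ?_ ?_ ?_
    hc
  · intro w
    rwa [zero_smul]
  · intro c c' _ _ h h' w
    rw [add_smul]
    exact add _ _ (h w) (h' w)
  · intro t c _ h w
    rw [smul_eq_mul, mul_comm, mul_smul]
    exact h _

namespace MultiFiltration

variable (F : MultiFiltration I) {q : Fin s → ℕ} (a : (i : Fin s) → Fin (q i) → I i)

/-- The ideal `∑_{i,j} a_{ij} F(n - e_i)`. -/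
def jointSum (n : Fin s → ℤ) : Ideal R :=
  ∑ i, ∑ j, Ideal.span {(a i j : R)} * F (n - Pi.single i 1)

theorem jointSum_le_iff {n : Fin s → ℤ} {J : Ideal R} :
    F.jointSum a n ≤ J ↔ ∀ i j, ∀ y ∈ F (n - Pi.single i 1), (a i j : R) * y ∈ J := by
  simp only [jointSum, Ideal.sum_eq_sup, Finset.sup_le_iff, Finset.mem_univ, true_implies,
    Ideal.span_singleton_mul_le_iff]

theorem mul_mem_jointSum (n : Fin s → ℤ) (i : Fin s) (j : Fin (q i)) {y : R}
    (hy : y ∈ F (n - Pi.single i 1)) : (a i j : R) * y ∈ F.jointSum a n :=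
  (F.jointSum_le_iff a).mp le_rfl i j y hy

theorem jointSum_le (n : Fin s → ℤ) : F.jointSum a n ≤ F n := by
  refine (F.jointSum_le_iff a).mpr fun i j y hy => ?_
  have h := F.pow_mul_le (Pi.single i 1) (n - Pi.single i 1)
  rw [add_sub_cancel, idealPow_single] at h
  exact h (Ideal.mul_mem_mul (a i j).2 hy)

theorem jointSum_anti {m n : Fin s → ℤ} (h : n ≤ m) : F.jointSum a m ≤ F.jointSum a n :=
  (F.jointSum_le_iff a).mpr fun i j _ hy =>
    F.mul_mem_jointSum a n i j (F.anti _ _ (sub_le_sub_right h _) hy)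

/-- In degree `n`, multiples of the initial forms `a_{ij}^*` in `G(F)` come from
`∑ a_{ij} F(n - e_i)`. -/
theorem coeff_mem_of_assocMk_mem (f : F.reesModule)
    (hf : F.assocMk f ∈
      Ideal.ofList ((jointIndexList q).map fun t => initialForm I t.1 (a t.1 t.2))
      • (⊤ : Submodule (AssocRing I) F.Assoc)) {n : Fin s → ℤ} (hn : 0 ≤ n) :
    (f : MLaurent R s).coeff n ∈ F.jointSum a n ⊔ F (n + 1) := by
  have key : ∀ f g : F.reesModule, F.assocMk f = F.assocMk g →
      (g : MLaurent R s).coeff n ∈ F.jointSum a n ⊔ F (n + 1) →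
      (f : MLaurent R s).coeff n ∈ F.jointSum a n ⊔ F (n + 1) := by
    intro f g h hg
    rw [← sub_eq_zero, ← map_sub, assocMk_eq_zero_iff] at h
    have h1 := h n
    rw [natPart_of_nonneg _ hn] at h1
    have h2 := Ideal.add_mem _ (Ideal.mem_sup_right (S := F.jointSum a n) h1) hg
    rwa [← MLaurent.coeff_add, ← Submodule.coe_add, sub_add_cancel] at h2
  refine smul_top_induction (P := fun w => ∀ f : F.reesModule, F.assocMk f = w →
    (f : MLaurent R s).coeff n ∈ F.jointSum a n ⊔ F (n + 1)) ?_ ?_ ?_ hf f rfl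
  · intro f hf
    exact key f 0 (by rw [hf, map_zero]) (Ideal.zero_mem _)
  · intro w w' h h' f hf
    obtain ⟨g, rfl⟩ := F.assocMk_surjective w
    obtain ⟨g', rfl⟩ := F.assocMk_surjective w'
    exact key f (g + g') (by rw [hf, map_add]) (Ideal.add_mem _ (h g rfl) (h' g' rfl))
  · intro b hb w f hf
    obtain ⟨⟨i, j⟩, -, rfl⟩ := List.mem_map.mp hb
    obtain ⟨g, rfl⟩ := F.assocMk_surjective w
    refine key f _ (hf.trans (F.mk_smul_assocMk _ g)) (Ideal.mem_sup_left ?_)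
    rw [coe_smul_reesModule, MLaurent.coeff_single_mul]
    exact F.mul_mem_jointSum a n i j (natPart_le _ _ (g.2 _))

/-- If `F(n) = ∑ a_{ij} F(n - e_i)` with `n ≥ (1, …, 1)`, then `G(F)_n` is contained in the
submodule generated by the initial forms `a_{ij}^*`. -/
theorem assocPiece_le_of_le_jointSum {n : Fin s → ℤ} (hn : 1 ≤ n) (h : F n ≤ F.jointSum a n)
    {z : F.Assoc} (hz : z ∈ F.assocPiece n) :
    z ∈ Ideal.ofList ((jointIndexList q).map fun t => initialForm I t.1 (a t.1 t.2))
      • (⊤ : Submodule (AssocRing I) F.Assoc) := by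
  set N := Ideal.ofList ((jointIndexList q).map fun t => initialForm I t.1 (a t.1 t.2))
      • (⊤ : Submodule (AssocRing I) F.Assoc) with hN
  have h0 : 0 ≤ n := zero_le_one.trans hn
  -- The coefficients `y` for which the class of `y t^n` lies in the submodule form an ideal.
  let K : Ideal R :=
    { carrier := {y | ∃ f : F.reesModule, (f : MLaurent R s) = MLaurent.single n y ∧
        F.assocMk f ∈ N}
      zero_mem' := ⟨0, (MLaurent.single_zero n).symm, by rw [map_zero]; exact N.zero_mem⟩
      add_mem' := by
        rintro y y' ⟨f, hf, hfN⟩ ⟨f', hf', hfN'⟩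
        refine ⟨f + f', ?_, by rw [map_add]; exact N.add_mem hfN hfN'⟩
        rw [Submodule.coe_add, hf, hf', MLaurent.single_add]
      smul_mem' := by
        rintro c y ⟨f, hf, hfN⟩
        refine ⟨(⟨MLaurent.single 0 c, single_mem_coeffIn ?_⟩ : reesRing I) • f, ?_,
          N.smul_mem (AssocRing.mk I _) hfN⟩
        · rw [natPart_of_nonneg _ le_rfl, idealPow_of_nonpos I le_rfl]
          trivial
        · rw [coe_smul_reesModule, hf, MLaurent.single_mul_single, zero_add]
          rfl }
  have hK : F.jointSum a n ≤ K := by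
    refine (F.jointSum_le_iff a).mpr fun i j y hy => ?_
    have hi : 0 ≤ n - Pi.single i 1 := by
      intro l
      have h1 : 1 ≤ n l := hn l
      simp only [Pi.zero_apply, Pi.sub_apply, Pi.single_apply]
      split_ifs <;> omega
    let g : F.reesModule := ⟨MLaurent.single (n - Pi.single i 1) y,
      single_mem_coeffIn (by rwa [natPart_of_nonneg _ hi])⟩
    have hb : initialForm I i (a i j) ∈
        Ideal.ofList ((jointIndexList q).map fun t => initialForm I t.1 (a t.1 t.2)) :=
      Ideal.subset_span (List.mem_map.mpr ⟨⟨i, j⟩, mem_jointIndexList _, rfl⟩)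
    have hmem : initialForm I i (a i j) • F.assocMk g ∈ N :=
      Submodule.smul_mem_smul hb Submodule.mem_top
    refine ⟨_, ?_, (F.mk_smul_assocMk _ g) ▸ hmem⟩
    rw [coe_smul_reesModule, MLaurent.single_mul_single, add_sub_cancel]
  obtain ⟨f, hf, rfl⟩ := hz
  have hfn := f.2 n
  rw [natPart_of_nonneg _ h0] at hfn
  obtain ⟨f', hf', hN'⟩ := hK (h hfn)
  rw [← MLaurent.eq_single hf] at hf'
  exact Subtype.ext hf' ▸ hN'

/-- Descent from high degrees: the contributions of `F(n + e)`, `F(n + 2e)`, … are absorbed, since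
`F` is generated by the joint reduction in high degrees. -/
theorem le_jointSum_of_le_sup (k : Fin s → ℤ) (hk : ∀ n, k ≤ n → F n ≤ F.jointSum a n)
    {n : Fin s → ℤ} (h : ∀ n', n ≤ n' → F n' ≤ F.jointSum a n' ⊔ F (n' + 1)) :
    F n ≤ F.jointSum a n := by
  have key : ∀ t : ℕ, F n ≤ F.jointSum a n ⊔ F (n + t • 1) := by
    intro t
    induction t with
    | zero =>
      rw [zero_smul, add_zero]
      exact le_sup_right
    | succ t ih =>
      have hle : n ≤ n + t • (1 : Fin s → ℤ) :=
        le_add_of_nonneg_right (nsmul_nonneg zero_le_one t)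
      refine ih.trans (sup_le le_sup_left ((h _ hle).trans ?_))
      rw [succ_nsmul, ← add_assoc]
      exact sup_le_sup_right (F.jointSum_anti a hle) _
  obtain ⟨t, ht⟩ := exists_le_add_nsmul (le_refl (1 : Fin s → ℤ)) n k
  exact (key t).trans (sup_le le_rfl ((hk _ ht).trans
    (F.jointSum_anti a (le_add_of_nonneg_right (nsmul_nonneg zero_le_one t)))))

/-- Replacing negative entries of `n` by zero does not change the terms of the joint reduction. -/
theorem jointSum_sup_zero (hF : F.IsAdmissible) (n : Fin s → ℤ) :
    F.jointSum a (n ⊔ 0) = F.jointSum a n := by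
  have key : ∀ i, F (n ⊔ 0 - Pi.single i 1) = F (n - Pi.single i 1) := by
    intro i
    rw [hF.eq_pos, hF.eq_pos (n - Pi.single i 1)]
    congr 1
    funext j
    have h : (0 : Fin s → ℤ) ≤ Pi.single i 1 := Pi.single_nonneg.mpr zero_le_one
    have hj : 0 ≤ (Pi.single i 1 : Fin s → ℤ) j := h j
    simp only [Pi.sup_apply, Pi.sub_apply, Pi.zero_apply]
    omega
  simp only [jointSum, key]

end MultiFiltration

end JointReduction

end

theorem mainTheorem4 {R : Type*} [CommRing R] [IsLocalRing R] [IsNoetherianRing R]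
    (d : ℕ) (hd : 1 ≤ d) (hdim : ringKrullDim R = d)
    (s : ℕ) (I : Fin s → Ideal R) (hI : ∀ i, (I i).radical = IsLocalRing.maximalIdeal R)
    (F : MultiFiltration I) (hF : F.IsAdmissible)
    (m : Fin s → ℤ) (hm : HyryCondition (assocRingPiece I) F.assocPiece m)
    (q : Fin s → ℕ) (hq : ∑ i, q i = d)
    (a : (i : Fin s) → Fin (q i) → I i) (ha : F.IsJointReduction a)
    (hreg : IsFilterRegularSeq F.assocPiece
      (List.ofFn fun i => List.ofFn fun j => initialForm I i (a i j)).flatten) :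
    ∀ n : Fin s → ℤ, m + (fun i => (q i : ℤ)) ≤ n →
      F n = ∑ i, ∑ j, Ideal.span {(a i j : R)} * F (n - Pi.single i 1) := by
  intro n hn
  obtain ⟨r, x, δ, hx, hspan, hH⟩ := hm
  obtain ⟨k, hk⟩ := ha
  have hlarge : ∀ n : Fin s → ℤ, (fun i => (k i : ℤ)) ≤ n → F n ≤ F.jointSum a n :=
    fun n hn => (hk n hn).ge
  have hδ : ∀ i, x i = 0 ∨ 1 ≤ δ i := fun i =>
    eq_zero_or_one_le_of_mem_plusPlusIdeal (hspan ▸ Ideal.subset_span ⟨i, rfl⟩) (hx i)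
  rw [← map_jointIndexList fun i j => initialForm I i (a i j)] at hreg
  have hstep : ∀ n : Fin s → ℤ, 0 ≤ n → m + (fun i => (q i : ℤ)) ≤ n →
      F n ≤ F.jointSum a n ⊔ F (n + 1) := by
    intro n h0 hn y hy
    let f : F.reesModule := ⟨MLaurent.single n y,
      single_mem_coeffIn (by rwa [natPart_of_nonneg _ h0])⟩
    have hf : F.assocMk f ∈ F.assocPiece n :=
      ⟨f, fun _ hl => MLaurent.coeff_single_of_ne hl _, rfl⟩
    rw [← sum_degree_jointIndexList] at hn
    have hmem := mem_smul_top_of_isFilterRegularSeq (jointIndexList q)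
      (fun t => initialForm I t.1 (a t.1 t.2)) (fun t => Pi.single t.1 1)
      (fun t _ => initialForm_mem_assocRingPiece t.1 (a t.1 t.2))
      (fun t _ => Pi.single_nonneg.mpr zero_le_one) F.gradedProj hx hδ hreg
      (fun p n hn => subsingleton_localCohomologyPiece_iff.mp (hH p n hn))
      ((fun i => (k i : ℤ)) ⊔ 1)
      (fun l hl z hz => F.assocPiece_le_of_le_jointSum a (le_sup_right.trans hl)
        (hlarge l (le_sup_left.trans hl)) hz) hn hf
    have h := F.coeff_mem_of_assocMk_mem a f hmem h0
    rwa [MLaurent.coeff_single_self] at h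
  refine le_antisymm ?_ (F.jointSum_le a n)
  -- Entries of `n` may be negative, where `G(F)` has no pieces: pass to `n⁺`.
  change F n ≤ F.jointSum a n
  rw [hF.eq_pos n, ← F.jointSum_sup_zero a hF n]
  exact F.le_jointSum_of_le_sup a _ hlarge fun n' hn' =>
    hstep n' (le_sup_right.trans hn') (hn.trans (le_sup_left.trans hn'))
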